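/- Let $G$ be a connected real Lie group whose Lie algebra $\mathfrak g$ is semisimple, and let $H\subset G$ be a maximal torus, that is, a compact connected abelian subgroup not properly contained in another such subgroup. Let $\mathfrak h$ be the Lie algebra of $H$ and $dh$ its normalised Haar measure. Fix an $\mathrm{Ad}_H$-invariant inner product $\langle\cdot,\cdot\rangle$ on $\mathfrak g$, put $\mathfrak m=\mathfrak h^{\perp}$, and let $\mathfrak m=\mathfrak m_0\oplus\mathfrak m_1\oplus\dots\oplus\mathfrak m_r$ be an orthogonal decomposition into $\mathrm{Ad}_H$-invariant subspaces, where $\mathfrak m_0=\{X\in\mathfrak m:\mathrm{Ad}(h)X=X\ \forall h\in H\}$ and $\mathfrak m_j$ is irreducible for $j\ne 0$. Let $A_1,\dots,A_N\in\mathfrak h$ generate $\mathfrak h$ as a Lie algebra, and let $\mathcal L_0=\frac12\sum_{k=1}^N (A_k)^2$ (so that there is no drift, $A_0=0$), where the $A_k$ act as left invariant vector fields on $H$. Let $l\neq 0$. Then there is a number $\lambda_l>0$, uniquely determined by $$\tfrac12\sum_{k=1}^N \mathrm{ad}^2(A_k)\big|_{\mathfrak m_l}=-\lambda_l\,\mathrm{Id}_{\mathfrak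 m_l},$$ such that the following holds for every $Y_0\in\mathfrak m_l$ and every orthonormal basis $Y_1,\dots,Y_d$ of $\mathfrak m_l$. Let $\alpha_j(h)=\langle \mathrm{Ad}(h)Y_0,Y_j\rangle$ for $h\in H$. The Poisson equations $\mathcal L_0\beta_j=\alpha_j$ have smooth solutions on $H$; and for any choice of $C^2$ solutions $\beta_j=\mathcal L_0^{-1}\alpha_j$, the effective operator $$\bar{\mathcal L}f=-\sum_{i,j=1}^d\Big(\int_H \alpha_i\,\mathcal L_0^{-1}\alpha_j\,dh\Big)L_{Y_i^*}L_{Y_j^*}f,\qquad f\in C^2(G;\mathbb R),$$ where $Y^*$ is the left invariant vector field on $G$ generated by $Y\in\mathfrak g$, satisfies $$\bar{\mathcal L}=\frac{|Y_0|^2}{2\lambda_l}\,\Delta_{\mathfrak m_l},\qquad \Delta_{\mathfrak m_l}=\sum_{j=1}^d L_{Z_j^*}L_{Z_j^*}\ \text{ for any orthonormal basis } Z_1,\dots,Z_d \text{ of } \mathfrak m_l .$$ -/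

import Mathlib

open scoped Manifold ContDiff

namespace EffectiveLimit

/-- A smooth real Lie group has the regularity over which Mathlib builds its Lie algebra. -/
instance leInfty_minSmoothness : ENat.LEInfty (minSmoothness ℝ 3) :=
  ⟨by rw [minSmoothness_of_isRCLikeNormedField]; exact ENat.LEInfty.out⟩

noncomputable section

section Group

variable {E : Type*} [NormedAddCommGroup E] [NormedSpace ℝ E]
  {G : Type*} [TopologicalSpace G] [ChartedSpace E G] [Group G]

/-- The adjoint action `Ad g` on the Lie algebra of `G`: the derivative at the identity of the
conjugation `x ↦ g x g⁻¹`. -/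
def adjoint (g : G) : GroupLieAlgebra 𝓘(ℝ, E) G →L[ℝ] GroupLieAlgebra 𝓘(ℝ, E) G :=
  mfderiv 𝓘(ℝ, E) 𝓘(ℝ, E) (fun x : G => g * x * g⁻¹) 1

/-- `L_X f`: the derivative of `f` along the left invariant vector field generated by `X`. -/
def leftDeriv (X : GroupLieAlgebra 𝓘(ℝ, E) G) (f : G → ℝ) : G → ℝ :=
  fun g => mfderiv 𝓘(ℝ, E) 𝓘(ℝ, ℝ) f g (mulInvariantVectorField X g)

/-- The Hörmander type operator `½ ∑ₖ (Aₖ)² + A₀` of left invariant vector fields. -/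
def hormanderOp {N : ℕ} (A₀ : GroupLieAlgebra 𝓘(ℝ, E) G)
    (A : Fin N → GroupLieAlgebra 𝓘(ℝ, E) G) (u : G → ℝ) : G → ℝ :=
  fun g => 1 / 2 * ∑ k, leftDeriv (A k) (leftDeriv (A k) u) g + leftDeriv A₀ u g

/-- The operator `∑ⱼ L_{Yⱼ} L_{Yⱼ}` (for `Y` an orthonormal basis of a subspace `V` of the Lie
algebra this is `Δ_V`). -/
def sumSquares {d : ℕ} (Y : Fin d → GroupLieAlgebra 𝓘(ℝ, E) G) (f : G → ℝ) : G → ℝ :=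
  fun g => ∑ j, leftDeriv (Y j) (leftDeriv (Y j) f) g

/-- `Y` is an orthonormal basis of the subspace `V` for the inner product `B`. -/
structure IsOrthonormalBasisOf (B : LinearMap.BilinForm ℝ (GroupLieAlgebra 𝓘(ℝ, E) G))
    (V : Submodule ℝ (GroupLieAlgebra 𝓘(ℝ, E) G)) {d : ℕ}
    (Y : Fin d → GroupLieAlgebra 𝓘(ℝ, E) G) : Prop where
  orthonormal : ∀ i j, B (Y i) (Y j) = if i = j then 1 else 0
  span_eq : Submodule.span ℝ (Set.range Y) = V

/-- `B` is an `Ad_H`-invariant inner product on the Lie algebra of `G`. -/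
structure IsAdInvariantInner (H : Subgroup G)
    (B : LinearMap.BilinForm ℝ (GroupLieAlgebra 𝓘(ℝ, E) G)) : Prop where
  symm : ∀ X Y, B X Y = B Y X
  pos : ∀ X, X ≠ 0 → 0 < B X X
  invariant : ∀ h ∈ H, ∀ X Y, B (adjoint h X) (adjoint h Y) = B X Y

/-- `V` is stable under `Ad h` for all `h ∈ H`. -/
def IsAdInvariant (H : Subgroup G) (V : Submodule ℝ (GroupLieAlgebra 𝓘(ℝ, E) G)) : Prop :=
  ∀ h ∈ H, ∀ X ∈ V, adjoint h X ∈ V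

/-- `V` is a (nonzero) irreducible `Ad_H`-invariant subspace. -/
structure IsAdIrreducible (H : Subgroup G)
    (V : Submodule ℝ (GroupLieAlgebra 𝓘(ℝ, E) G)) : Prop where
  ne_bot : V ≠ ⊥
  invariant : IsAdInvariant H V
  eq_bot_or_eq : ∀ W ≤ V, IsAdInvariant H W → W = ⊥ ∨ W = V

/-- `K` is a torus in `G`: a compact connected abelian subgroup. -/
structure IsTorus (K : Subgroup G) : Prop where
  compact : IsCompact (K : Set G)
  connected : IsConnected (K : Set G)
  comm : ∀ x ∈ K, ∀ y ∈ K, x * y = y * x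

/-- `K` is a maximal torus of `G`: a torus not properly contained in another torus. -/
structure IsMaximalTorus (K : Subgroup G) : Prop extends IsTorus K where
  maximal : ∀ K' : Subgroup G, IsTorus K' → K ≤ K' → K' ≤ K

end Group

section Subgroup

variable {E : Type*} [NormedAddCommGroup E] [NormedSpace ℝ E]
  {G : Type*} [TopologicalSpace G] [ChartedSpace E G] [Group G]
  {F : Type*} [NormedAddCommGroup F] [NormedSpace ℝ F]
  (H : Subgroup G) [ChartedSpace F H]

/-- The given smooth structure on the subgroup `H`, whose topology is the subspace topology, makes
`H` an embedded submanifold of `G`: the inclusion is a smooth immersion. -/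
structure IsEmbeddedSubgroup : Prop where
  smooth : ContMDiff 𝓘(ℝ, F) 𝓘(ℝ, E) ∞ (Subtype.val : H → G)
  immersion : ∀ h : H,
    Function.Injective (mfderiv 𝓘(ℝ, F) 𝓘(ℝ, E) (Subtype.val : H → G) h)

/-- The inclusion of the Lie algebra of `H` in the Lie algebra of `G`: the derivative at the
identity of the inclusion of groups. -/
def lieIncl : GroupLieAlgebra 𝓘(ℝ, F) H →L[ℝ] GroupLieAlgebra 𝓘(ℝ, E) G :=
  mfderiv 𝓘(ℝ, F) 𝓘(ℝ, E) (Subtype.val : H → G) 1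

/-- The Lie algebra `𝔥` of `H` as a subspace of the Lie algebra of `G`. -/
def lieSubspace : Submodule ℝ (GroupLieAlgebra 𝓘(ℝ, E) G) :=
  LinearMap.range (lieIncl H : GroupLieAlgebra 𝓘(ℝ, F) H →L[ℝ] GroupLieAlgebra 𝓘(ℝ, E) G).toLinearMap

/-- `𝔪 = 𝔪₀ ⊕ 𝔪₁ ⊕ ⋯ ⊕ 𝔪ᵣ` is an orthogonal decomposition of `𝔪 = 𝔥^⊥`, where `𝔪₀` consists of
the vectors of `𝔪` fixed by `Ad_H`, and the other summands are `Ad_H`-invariant and irreducible. -/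
structure IsAdDecomposition (B : LinearMap.BilinForm ℝ (GroupLieAlgebra 𝓘(ℝ, E) G)) {r : ℕ}
    (𝔪 : Fin (r + 1) → Submodule ℝ (GroupLieAlgebra 𝓘(ℝ, E) G)) : Prop where
  orthogonal : ∀ i j, i ≠ j → ∀ X ∈ 𝔪 i, ∀ Y ∈ 𝔪 j, B X Y = 0
  iSup_eq : ⨆ i, 𝔪 i = B.orthogonal (lieSubspace (F := F) H)
  mem_zero : ∀ X, X ∈ 𝔪 0 ↔
    X ∈ B.orthogonal (lieSubspace (F := F) H) ∧ ∀ h ∈ H, adjoint h X = X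
  irreducible : ∀ j, j ≠ 0 → IsAdIrreducible H (𝔪 j)

/-- `A₁, …, A_N`, elements of the Lie algebra of `H`, generate it as a Lie algebra. -/
def IsLieGenerating [CompleteSpace E] [LieGroup 𝓘(ℝ, E) ∞ G] {N : ℕ}
    (A : Fin N → GroupLieAlgebra 𝓘(ℝ, F) H) : Prop :=
  (LieSubalgebra.lieSpan ℝ (GroupLieAlgebra 𝓘(ℝ, E) G)
    (Set.range fun k => (lieIncl H (A k) : GroupLieAlgebra 𝓘(ℝ, E) G))).toSubmodule
      = lieSubspace (F := F) H

variable {H}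

/-- The function `α(Y₀, Y)(h) = ⟨Ad(h) Y₀, Y⟩` on `H`. -/
def adCoeff (B : LinearMap.BilinForm ℝ (GroupLieAlgebra 𝓘(ℝ, E) G))
    (Y₀ Y : GroupLieAlgebra 𝓘(ℝ, E) G) : H → ℝ :=
  fun h => B (adjoint (h : G) Y₀) Y

/-- `β` is a (`C²`) solution on `H` of the Poisson equation `𝓛₀ β = α`, where
`𝓛₀ = ½ ∑ₖ (Aₖ)² + A₀`; that is, `β` is a value of `𝓛₀⁻¹ α`. -/
structure IsPoissonSolution {N : ℕ} (A₀ : GroupLieAlgebra 𝓘(ℝ, F) H)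
    (A : Fin N → GroupLieAlgebra 𝓘(ℝ, F) H) (α β : H → ℝ) : Prop where
  contMDiff : ContMDiff 𝓘(ℝ, F) 𝓘(ℝ, ℝ) 2 β
  eq : ∀ h, hormanderOp A₀ A β h = α h

/-- The effective operator
`𝓛̄ f = - ∑ᵢⱼ (∫_H α(Y₀, Yᵢ) 𝓛₀⁻¹ α(Y₀, Yⱼ) dh) L_{Yᵢ} L_{Yⱼ} f`, where `β j` stands for
`𝓛₀⁻¹ α(Y₀, Yⱼ)`. -/
def effectiveOp [MeasurableSpace G] (μ : MeasureTheory.Measure H)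
    (B : LinearMap.BilinForm ℝ (GroupLieAlgebra 𝓘(ℝ, E) G)) {d : ℕ}
    (Y₀ : GroupLieAlgebra 𝓘(ℝ, E) G) (Y : Fin d → GroupLieAlgebra 𝓘(ℝ, E) G)
    (β : Fin d → H → ℝ) (f : G → ℝ) : G → ℝ :=
  fun g => -∑ i, ∑ j, (∫ h : H, adCoeff B Y₀ (Y i) h * β j h ∂μ) *
    leftDeriv (Y i) (leftDeriv (Y j) f) g

end Subgroup

end

end EffectiveLimit

open EffectiveLimit

/-! Write `α(X, Y)(h) = ⟨Ad(h) X, Y⟩` and `T = ½ ∑ₖ ad²(Aₖ)`. As `Ad` is a homomorphism with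
derivative `ad` at the identity, a left invariant field `A` on `H` sends `α(X, Y)` to `α([A, X], Y)`
(`leftDeriv_adCoeff`), so `𝓛₀ α(X, Y) = α(T X, Y)`.

Because `H` is abelian and `B` invariant, each `ad Aₖ` commutes with `Ad_H` and is skew. Hence `T`
is symmetric and commutes with `Ad_H`, and Schur's lemma makes it a scalar `-λ` on `𝔪ₗ`
(`IsAdDecomposition.exists_eigenvalue`). From `⟨T X, X⟩ = -½ ∑ₖ |[Aₖ, X]|²` one gets `λ > 0`:
otherwise `X` commutes with the generators, thus with `𝔥`, is fixed by the connected group `H`, and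
lies in `𝔪₀ ⟂ 𝔪ₗ`. So the `αⱼ` are eigenfunctions and `-αⱼ/λ` solves the Poisson equation. For an
arbitrary solution, symmetry of `𝓛₀` in `L²(H)` gives `∫ αᵢ βⱼ = -λ⁻¹ ∫ αᵢ αⱼ`, with no need to
classify solutions.

It remains to see that `∫ αᵢ αⱼ = ½ |Y₀|² δᵢⱼ`. Some `J = ad Aₖ` is nonzero on `𝔪ₗ`, which forces
`𝔪ₗ` to be a plane `span {X, J X}` (`eq_span_pair_of_skew_of_commute`). Integration by parts shows
`J` skew for the correlation form too (`correlationForm_lie_skew`), so that form is a multiple of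
`B` (`eq_smul_of_skew`). Its trace is `|Y₀|²` and the dimension is two, whence the factor `½`. -/

namespace EffectiveLimit

/-! ### Schur's lemma for symmetric and skew endomorphisms. -/

section LinearAlgebra

variable {L : Type*} [AddCommGroup L] [Module ℝ L]

/-- A symmetric endomorphism of a nonzero finite-dimensional space with a positive definite form
has an eigenvector. -/
lemma exists_eigenvector_of_symmetric [FiniteDimensional ℝ L] [Nontrivial L]
    (B : LinearMap.BilinForm ℝ L) (hs : ∀ x y, B x y = B y x) (hp : ∀ x, x ≠ 0 → 0 < B x x)
    (T : Module.End ℝ L) (hT : ∀ x y, B (T x) y = B x (T y)) :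
    ∃ c : ℝ, ∃ x, x ≠ 0 ∧ T x = c • x := by
  -- The form becomes a local inner product, so that the spectral theorem applies.
  let core : InnerProductSpace.Core ℝ L :=
    { inner := fun x y => B x y
      conj_inner_symm := fun x y => by simp [hs y x]
      re_inner_nonneg := fun x => by
        rcases eq_or_ne x 0 with rfl | h
        · simp
        · simpa using (hp x h).le
      add_left := fun x y z => by simp
      smul_left := fun x y r => by simp
      definite := fun x h => by
        by_contra hx
        exact (hp x hx).ne' h }
  let _ : NormedAddCommGroup L := core.toNormedAddCommGroup
  let _ : InnerProductSpace ℝ L := InnerProductSpace.ofCore core.toCore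
  have hT' : T.IsSymmetric := fun x y => hT x y
  obtain ⟨x, hx⟩ := (hT'.hasEigenvalue_iSup_of_finiteDimensional).exists_hasEigenvector
  exact ⟨_, x, hx.2, hx.apply_eq_smul⟩

/-- Schur's lemma for symmetric endomorphisms: a symmetric endomorphism of an irreducible `V`
which commutes with the action is a scalar. -/
lemma scalar_of_symmetric_of_commute [FiniteDimensional ℝ L] {ι : Type*}
    (B : LinearMap.BilinForm ℝ L) (hs : ∀ x y, B x y = B y x) (hp : ∀ x, x ≠ 0 → 0 < B x x)
    (ρ : ι → Module.End ℝ L) (V : Submodule ℝ L) (hV : V ≠ ⊥)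
    (hinv : ∀ i, ∀ x ∈ V, ρ i x ∈ V)
    (hirr : ∀ W ≤ V, (∀ i, ∀ x ∈ W, ρ i x ∈ W) → W = ⊥ ∨ W = V)
    (T : Module.End ℝ L) (hTV : ∀ x ∈ V, T x ∈ V)
    (hTs : ∀ x ∈ V, ∀ y ∈ V, B (T x) y = B x (T y))
    (hTc : ∀ i, ∀ x ∈ V, T (ρ i x) = ρ i (T x)) :
    ∃ c : ℝ, ∀ x ∈ V, T x = c • x := by
  have : Nontrivial V := Submodule.nontrivial_iff_ne_bot.2 hV
  obtain ⟨c, ⟨x, hxV⟩, hx, hcx⟩ := exists_eigenvector_of_symmetric (L := V)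
    (B.restrict V) (fun x y => hs x y) (fun x h => hp x (by simpa using h))
    (T.restrict hTV) (fun x y => hTs x x.2 y y.2)
  refine ⟨c, fun y hy => ?_⟩
  let W : Submodule ℝ L := V ⊓ LinearMap.ker (T - c • LinearMap.id)
  have hmem : ∀ z, z ∈ W ↔ z ∈ V ∧ T z = c • z := fun z => by
    simp [W, sub_eq_zero]
  have hW : W = ⊥ ∨ W = V := by
    refine hirr W inf_le_left fun i z hz => ?_
    rw [hmem] at hz ⊢
    exact ⟨hinv i z hz.1, by rw [hTc i z hz.1, hz.2, map_smul]⟩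
  have hxW : x ∈ W := (hmem x).2 ⟨hxV, congrArg Subtype.val hcx⟩
  rcases hW with hW | hW
  · exact absurd (by simpa [hW] using hxW) (by simpa using hx)
  · rw [← hW] at hy
    exact ((hmem y).1 hy).2

/-- An irreducible orthogonal representation of an abelian group which commutes with a nonzero skew
endomorphism `J` is spanned by `x` and `J x`, for any nonzero `x`, and `J ^ 2` is a negative
scalar. -/
lemma eq_span_pair_of_skew_of_commute [FiniteDimensional ℝ L] {ι : Type*}
    (B : LinearMap.BilinForm ℝ L) (hs : ∀ x y, B x y = B y x) (hp : ∀ x, x ≠ 0 → 0 < B x x)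
    (ρ : ι → Module.End ℝ L) (σ : ι → ι) (hσ : ∀ i x y, B (ρ i x) y = B x (ρ (σ i) y))
    (hσ' : ∀ i x y, B (ρ (σ i) x) y = B x (ρ i y))
    (hcomm : ∀ i j x, ρ i (ρ j x) = ρ j (ρ i x))
    (V : Submodule ℝ L) (hV : V ≠ ⊥)
    (hinv : ∀ i, ∀ x ∈ V, ρ i x ∈ V)
    (hirr : ∀ W ≤ V, (∀ i, ∀ x ∈ W, ρ i x ∈ W) → W = ⊥ ∨ W = V)
    (J : Module.End ℝ L) (hJV : ∀ x ∈ V, J x ∈ V)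
    (hJs : ∀ x y, B (J x) y = - B x (J y))
    (hJc : ∀ i x, J (ρ i x) = ρ i (J x)) (hJ : ∃ x ∈ V, J x ≠ 0) :
    ∃ c : ℝ, 0 < c ∧ (∀ x ∈ V, J (J x) = -(c • x)) ∧
      ∀ x ∈ V, x ≠ 0 → V = Submodule.span ℝ {x, J x} := by
  obtain ⟨c', hc'⟩ := scalar_of_symmetric_of_commute B hs hp ρ V hV hinv hirr (J * J)
    (fun x hx => hJV _ (hJV _ hx)) (fun x _ y _ => by simp [hJs])
    (fun i x _ => by simp [hJc])
  -- `B (J x) (J x) = -B x (J (J x)) = -c' * B x x`, and the left side is positive for some `x`.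
  have hc : c' < 0 := by
    obtain ⟨x, hx, hJx⟩ := hJ
    have h1 := hp _ hJx
    rw [hJs] at h1
    have h2 : J (J x) = c' • x := hc' x hx
    rw [h2, map_smul, smul_eq_mul] at h1
    have hx0 : x ≠ 0 := fun h => hJx (by simp [h])
    have := hp x hx0
    by_contra hcon
    nlinarith [mul_nonneg (not_lt.1 hcon) this.le]
  refine ⟨-c', by linarith, fun x hx => by simpa using hc' x hx, fun x hx hx0 => ?_⟩
  have hW : Submodule.span ℝ {x, J x} ≤ V := by
    rw [Submodule.span_le]
    rintro y (rfl | rfl)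
    exacts [hx, hJV _ hx]
  -- Split `ρ i` into symmetric and skew parts. The symmetric part is a scalar by Schur; the skew
  -- part becomes symmetric after composition with `J`, hence is a multiple of `J`. So every `ρ i`
  -- preserves `span {x, J x}`.
  have key : ∀ i, ∃ a b : ℝ, ∀ y ∈ V, ρ i y = a • y + b • J y := by
    intro i
    obtain ⟨a, ha⟩ := scalar_of_symmetric_of_commute B hs hp ρ V hV hinv hirr
      (ρ i + ρ (σ i)) (fun x hx => V.add_mem (hinv _ _ hx) (hinv _ _ hx))
      (fun x _ y _ => by simp [hσ i, hσ' i, add_comm])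
      (fun j x _ => by simp [hcomm _ j])
    obtain ⟨b, hb⟩ := scalar_of_symmetric_of_commute B hs hp ρ V hV hinv hirr
      (J * (ρ i - ρ (σ i))) (fun x hx => hJV _ (V.sub_mem (hinv _ _ hx) (hinv _ _ hx)))
      (fun x _ y _ => by simp [hσ i, hσ' i, hJs, hJc]; ring)
      (fun j x _ => by simp [hcomm _ j, hJc])
    refine ⟨a / 2, b / (2 * c'), fun y hy => ?_⟩
    have h1 : ρ i y + ρ (σ i) y = a • y := ha y hy
    have h2 : J (ρ i y - ρ (σ i) y) = b • y := hb y hy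
    have h3 : c' • (ρ i y - ρ (σ i) y) = b • J y := by
      rw [← hc' _ (V.sub_mem (hinv _ _ hy) (hinv _ _ hy)), Module.End.mul_apply, h2, map_smul]
    have h4 : ρ i y - ρ (σ i) y = (b / c') • J y := by
      rw [div_eq_inv_mul, mul_smul, ← h3, smul_smul, inv_mul_cancel₀ hc.ne, one_smul]
    have h5 : (2 : ℝ) • ρ i y = a • y + (b / c') • J y := by
      rw [← h1, ← h4, two_smul]; abel
    have h6 : ρ i y = (1 / 2 : ℝ) • (2 : ℝ) • ρ i y := by rw [smul_smul]; norm_num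
    rw [h6, h5, smul_add, smul_smul, smul_smul]
    congr 2 <;> field_simp
  refine ((hirr _ hW ?_).resolve_left ?_).symm
  · intro i y hy
    obtain ⟨a, b, hab⟩ := key i
    rw [hab y (hW hy)]
    refine Submodule.add_mem _ (Submodule.smul_mem _ _ hy) (Submodule.smul_mem _ _ ?_)
    obtain ⟨s, t, rfl⟩ := Submodule.mem_span_pair.1 hy
    rw [map_add, map_smul, map_smul, show J (J x) = c' • x from hc' x hx]
    exact Submodule.mem_span_pair.2 ⟨t * c', s, by rw [mul_smul, add_comm]⟩
  · intro h
    exact hx0 (by simpa [h] using Submodule.subset_span (R := ℝ) (Set.mem_insert x {J x}))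

/-- Two symmetric forms for which the complex structure `J` is skew are proportional on
a plane `span {x, J x}`. -/
lemma eq_smul_of_skew (B Q : LinearMap.BilinForm ℝ L)
    (hp : ∀ x, x ≠ 0 → 0 < B x x) (hs : ∀ x y, B x y = B y x) (hQs : ∀ x y, Q x y = Q y x)
    (J : Module.End ℝ L) (hJs : ∀ x y, B (J x) y = - B x (J y)) {V : Submodule ℝ L}
    (hQJ : ∀ x ∈ V, ∀ y ∈ V, Q (J x) y = - Q x (J y)) {c : ℝ} {x : L} (hx : x ≠ 0)
    (hJJ : J (J x) = -(c • x)) (hV : V = Submodule.span ℝ {x, J x}) :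
    ∃ q : ℝ, ∀ y ∈ V, ∀ z ∈ V, Q y z = q * B y z := by
  have hxV : x ∈ V := hV ▸ Submodule.subset_span (by simp)
  have hJV : J x ∈ V := hV ▸ Submodule.subset_span (by simp)
  -- For both forms `x` and `J x` are orthogonal and `J x` has square norm `c` times that of `x`, so
  -- the two Gram matrices are proportional.
  have hB0 : B x (J x) = 0 := by linarith [hJs x x, hs x (J x)]
  have hQ0 : Q x (J x) = 0 := by linarith [hQJ x hxV x hxV, hQs x (J x)]
  have hBJ : B (J x) (J x) = c * B x x := by simp [hJs, hJJ]
  have hQJ' : Q (J x) (J x) = c * Q x x := by simp [hQJ x hxV _ hJV, hJJ]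
  have hxx := (hp x hx).ne'
  refine ⟨Q x x / B x x, fun y hy z hz => ?_⟩
  rw [hV] at hy hz
  obtain ⟨s, t, rfl⟩ := Submodule.mem_span_pair.1 hy
  obtain ⟨s', t', rfl⟩ := Submodule.mem_span_pair.1 hz
  simp only [map_add, map_smul, LinearMap.add_apply, LinearMap.smul_apply, smul_eq_mul, hB0, hQ0,
    hBJ, hQJ', hs (J x) x, hQs (J x) x]
  field_simp
  ring

end LinearAlgebra
-- Smoothness of `Ad`, and its derivative `ad`, computed in a chart.
section AdjointCalculus

set_option linter.unusedSectionVars false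

open Filter Topology

variable {E : Type*} [NormedAddCommGroup E] [NormedSpace ℝ E]
  {G : Type*} [TopologicalSpace G] [ChartedSpace E G] [Group G]

variable (E G) in
/-- The multiplication of `G` read in the preferred chart at the identity. -/
noncomputable def chartMul (p : E × E) : E :=
  extChartAt 𝓘(ℝ, E) (1 : G)
    ((extChartAt 𝓘(ℝ, E) (1 : G)).symm p.1 * (extChartAt 𝓘(ℝ, E) (1 : G)).symm p.2)

variable (E G) in
/-- The coordinate of the identity in its preferred chart. -/
noncomputable def chartOne : E := extChartAt 𝓘(ℝ, E) (1 : G) 1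

/-- The derivative of a vector valued function, as a map between model spaces. -/
noncomputable def derivAt {V : Type*} [NormedAddCommGroup V] [NormedSpace ℝ V] (f : G → V) (g : G) :
    E →L[ℝ] V :=
  mfderiv 𝓘(ℝ, E) 𝓘(ℝ, V) f g

/-- `Ad g` as an endomorphism of the model space. -/
noncomputable def adjointModel (g : G) : E →L[ℝ] E := adjoint (E := E) g

variable (G) in
/-- The bracket of the Lie algebra of `G`, as an operation on the model space. -/
noncomputable def bracketModel (A X : E) : E :=
  Bracket.bracket (L := GroupLieAlgebra 𝓘(ℝ, E) G) (M := GroupLieAlgebra 𝓘(ℝ, E) G) A X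

@[simp]
lemma extChartAt_symm_chartOne : (extChartAt 𝓘(ℝ, E) (1 : G)).symm (chartOne E G) = 1 :=
  extChartAt_to_inv (1 : G)

lemma extChartAt_target_mem_nhds_chartOne :
    (extChartAt 𝓘(ℝ, E) (1 : G)).target ∈ 𝓝 (chartOne E G) :=
  extChartAt_target_mem_nhds (I := 𝓘(ℝ, E)) (1 : G)

lemma tendsto_left : Tendsto (fun x : E => (x, chartOne E G)) (𝓝 (chartOne E G))
    (𝓝 (chartOne E G, chartOne E G)) :=
  (Continuous.prodMk_left _).tendsto _

lemma tendsto_right : Tendsto (fun x : E => (chartOne E G, x)) (𝓝 (chartOne E G))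
    (𝓝 (chartOne E G, chartOne E G)) :=
  (Continuous.prodMk_right _).tendsto _

lemma one_mem_chart_source : (1 : G) ∈ (chartAt E (1 : G)).source := mem_chart_source E 1

lemma eventually_symm_mem_source : ∀ᶠ x in 𝓝 (chartOne E G),
    (extChartAt 𝓘(ℝ, E) (1 : G)).symm x ∈ (chartAt E (1 : G)).source := by
  filter_upwards [extChartAt_target_mem_nhds_chartOne (E := E) (G := G)] with x hx
  simpa using (extChartAt 𝓘(ℝ, E) (1 : G)).map_target hx

/-- The derivative at the identity of a vector valued function, read in the chart. -/
lemma derivAt_one_eq_fderiv {V : Type*} [NormedAddCommGroup V] [NormedSpace ℝ V] {f : G → V}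
    (hf : MDifferentiableAt 𝓘(ℝ, E) 𝓘(ℝ, V) f 1) :
    derivAt f 1 = fderiv ℝ (f ∘ (extChartAt 𝓘(ℝ, E) (1 : G)).symm) (chartOne E G) := by
  rw [derivAt, hf.mfderiv]
  simp only [writtenInExtChartAt, extChartAt_model_space_eq_id, PartialEquiv.refl_coe,
    Function.id_comp, modelWithCornersSelf_coe, Set.range_id, fderivWithin_univ]
  rfl

/-- A differentiable vector valued function is differentiable in the chart at the identity. -/
lemma hasFDerivAt_comp_extChartAt_symm {V : Type*} [NormedAddCommGroup V] [NormedSpace ℝ V]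
    {f : G → V} (hf : MDifferentiableAt 𝓘(ℝ, E) 𝓘(ℝ, V) f 1) :
    HasFDerivAt (f ∘ (extChartAt 𝓘(ℝ, E) (1 : G)).symm) (derivAt f 1) (chartOne E G) := by
  have h := hf.differentiableWithinAt_writtenInExtChartAt
  simp only [writtenInExtChartAt, extChartAt_model_space_eq_id, PartialEquiv.refl_coe,
    Function.id_comp, modelWithCornersSelf_coe, Set.range_id, differentiableWithinAt_univ] at h
  rw [derivAt_one_eq_fderiv hf]
  exact DifferentiableAt.hasFDerivAt h

lemma adjointModel_one (X : E) : adjointModel (1 : G) X = X := by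
  have h : (fun x : G => 1 * x * 1⁻¹) = id := by ext; simp
  change (mfderiv 𝓘(ℝ, E) 𝓘(ℝ, E) (fun x : G => 1 * x * 1⁻¹) 1 : E →L[ℝ] E) X = X
  rw [h, mfderiv_id]; rfl

variable [LieGroup 𝓘(ℝ, E) ∞ G]

lemma mdifferentiable_mul_left (g : G) : MDifferentiable 𝓘(ℝ, E) 𝓘(ℝ, E) (fun x : G => g * x) :=
  (contMDiff_mul_left (n := ∞)).mdifferentiable (by simp)

lemma mdifferentiable_mul_right (g : G) : MDifferentiable 𝓘(ℝ, E) 𝓘(ℝ, E) (fun x : G => x * g) :=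
  (contMDiff_mul_right (n := ∞)).mdifferentiable (by simp)

lemma mdifferentiable_conj (g : G) :
    MDifferentiable 𝓘(ℝ, E) 𝓘(ℝ, E) (fun x : G => g * x * g⁻¹) :=
  (mdifferentiable_mul_right g⁻¹).comp (mdifferentiable_mul_left g)

lemma adjointModel_mul (g h : G) (X : E) :
    adjointModel (g * h) X = adjointModel g (adjointModel h X) := by
  have e : (fun x : G => g * h * x * (g * h)⁻¹)
      = (fun x => g * x * g⁻¹) ∘ (fun x => h * x * h⁻¹) := by ext; simp [mul_assoc]
  have := mfderiv_comp (I := 𝓘(ℝ, E)) (I' := 𝓘(ℝ, E)) (I'' := 𝓘(ℝ, E)) (1 : G)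
    (mdifferentiable_conj (E := E) g _) (mdifferentiable_conj (E := E) h 1)
  change (mfderiv 𝓘(ℝ, E) 𝓘(ℝ, E) (fun x : G => g * h * x * (g * h)⁻¹) 1 : E →L[ℝ] E) X = _
  rw [e, this]
  -- The chain rule yields a derivative based at `h * 1 * h⁻¹`, which is only propositionally `1`;
  -- the base point is moved by substitution.
  have aux : ∀ y : G, y = 1 →
      (mfderiv 𝓘(ℝ, E) 𝓘(ℝ, E) (fun x => g * x * g⁻¹) y : E →L[ℝ] E)
        = (adjointModel g : E →L[ℝ] E) := by
    rintro _ rfl; rfl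
  exact congrArg (fun T : E →L[ℝ] E => T _) (aux _ (by simp))

/-- `g x = (g x g⁻¹) g`: the derivative of left translation is `Ad g` followed by right
translation. -/
lemma derivAt_mul_left_eq {V : Type*} [NormedAddCommGroup V] [NormedSpace ℝ V] {f : G → V} (g : G)
    (hf : MDifferentiableAt 𝓘(ℝ, E) 𝓘(ℝ, V) f g) (X : E) :
    derivAt (fun x => f (g * x)) 1 X = derivAt (fun x => f (x * g)) 1 (adjointModel g X) := by
  have e : (fun x => f (g * x)) = (fun x => f (x * g)) ∘ (fun x => g * x * g⁻¹) := by
    ext; simp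
  have hy : g * 1 * g⁻¹ = 1 := by simp
  have hd : MDifferentiableAt 𝓘(ℝ, E) 𝓘(ℝ, V) (fun x => f (x * g)) 1 :=
    MDifferentiableAt.comp (I' := 𝓘(ℝ, E)) 1 (by rwa [one_mul]) (mdifferentiable_mul_right g 1)
  have := mfderiv_comp_of_eq (I := 𝓘(ℝ, E)) (I' := 𝓘(ℝ, E)) (I'' := 𝓘(ℝ, V)) (x := (1 : G))
    hd (mdifferentiable_conj (E := E) g 1) hy
  rw [e, derivAt, this]
  have aux : ∀ y : G, y = 1 →
      derivAt (E := E) (fun x => f (x * g)) y = derivAt (fun x => f (x * g)) 1 := by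
    rintro _ rfl; rfl
  exact congrArg (fun T : E →L[ℝ] V => T _) (aux _ hy)

lemma contDiffAt_chartMul :
    ContDiffAt ℝ ∞ (chartMul E G) (chartOne E G, chartOne E G) := by
  have : IsManifold 𝓘(ℝ, E) ∞ G := inferInstance
  rw [← contMDiffAt_iff_contDiffAt]
  have hs : ContMDiffAt 𝓘(ℝ, E) 𝓘(ℝ, E) ∞ (extChartAt 𝓘(ℝ, E) (1 : G)).symm (chartOne E G) :=
    (contMDiffOn_extChartAt_symm 1).contMDiffAt extChartAt_target_mem_nhds_chartOne
  have h1 : ContMDiffAt 𝓘(ℝ, E × E) 𝓘(ℝ, E) ∞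
      (fun p : E × E => (extChartAt 𝓘(ℝ, E) (1 : G)).symm p.1) (chartOne E G, chartOne E G) :=
    ContMDiffAt.comp (I' := 𝓘(ℝ, E)) (chartOne E G, chartOne E G) hs
      (contDiff_fst.contDiffAt.contMDiffAt)
  have h2 : ContMDiffAt 𝓘(ℝ, E × E) 𝓘(ℝ, E) ∞
      (fun p : E × E => (extChartAt 𝓘(ℝ, E) (1 : G)).symm p.2) (chartOne E G, chartOne E G) :=
    ContMDiffAt.comp (I' := 𝓘(ℝ, E)) (chartOne E G, chartOne E G) hs
      (contDiff_snd.contDiffAt.contMDiffAt)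
  refine ContMDiffAt.comp (I' := 𝓘(ℝ, E)) (chartOne E G, chartOne E G) ?_ (h1.mul h2)
  apply contMDiffAt_extChartAt'
  rw [extChartAt_symm_chartOne, mul_one]
  exact one_mem_chart_source

lemma eventually_differentiableAt_chartMul :
    ∀ᶠ p in 𝓝 (chartOne E G, chartOne E G), DifferentiableAt ℝ (chartMul E G) p := by
  filter_upwards [((contDiffAt_chartMul (E := E) (G := G)).of_le
    (m := 1) (by simp)).eventually (by simp)] with p hp
  exact hp.differentiableAt (by simp)

/-- Translations become partial derivatives of `chartMul`, by the chain rule; with its right-hand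
counterpart this turns identities on `G` into identities between functions on `E`. -/
lemma derivAt_extChartAt_mul_left {x : E}
    (hx : DifferentiableAt ℝ (chartMul E G) (x, chartOne E G))
    (hx' : (extChartAt 𝓘(ℝ, E) (1 : G)).symm x ∈ (chartAt E (1 : G)).source) (X : E) :
    derivAt (fun y : G => extChartAt 𝓘(ℝ, E) (1 : G)
      ((extChartAt 𝓘(ℝ, E) (1 : G)).symm x * y)) 1 X
      = fderiv ℝ (chartMul E G) (x, chartOne E G) (0, X) := by
  rw [derivAt_one_eq_fderiv]
  · have := hx.hasFDerivAt.comp (f := fun e => (x, e)) (chartOne E G)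
      (hasFDerivAt_prodMk_right x (chartOne E G))
    exact congrArg (fun T : E →L[ℝ] E => T X) this.fderiv
  · have : IsManifold 𝓘(ℝ, E) 1 G := inferInstance
    refine MDifferentiableAt.comp (I' := 𝓘(ℝ, E)) 1
      (mdifferentiableAt_extChartAt ?_) (mdifferentiable_mul_left _ 1)
    rwa [mul_one]

lemma derivAt_extChartAt_mul_right {x : E}
    (hx : DifferentiableAt ℝ (chartMul E G) (chartOne E G, x))
    (hx' : (extChartAt 𝓘(ℝ, E) (1 : G)).symm x ∈ (chartAt E (1 : G)).source) (X : E) :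
    derivAt (fun y : G => extChartAt 𝓘(ℝ, E) (1 : G)
      (y * (extChartAt 𝓘(ℝ, E) (1 : G)).symm x)) 1 X
      = fderiv ℝ (chartMul E G) (chartOne E G, x) (X, 0) := by
  rw [derivAt_one_eq_fderiv]
  · have := hx.hasFDerivAt.comp (f := fun e => (e, x)) (chartOne E G)
      (hasFDerivAt_prodMk_left (chartOne E G) x)
    exact congrArg (fun T : E →L[ℝ] E => T X) this.fderiv
  · have : IsManifold 𝓘(ℝ, E) 1 G := inferInstance
    refine MDifferentiableAt.comp (I' := 𝓘(ℝ, E)) 1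
      (mdifferentiableAt_extChartAt ?_) (mdifferentiable_mul_right _ 1)
    rwa [one_mul]

/-- The equation determining `Ad` in the chart. -/
lemma eventually_fderiv_chartMul_eq (X : E) : ∀ᶠ x in 𝓝 (chartOne E G),
    fderiv ℝ (chartMul E G) (x, chartOne E G) (0, X)
      = fderiv ℝ (chartMul E G) (chartOne E G, x)
        (adjointModel ((extChartAt 𝓘(ℝ, E) (1 : G)).symm x) X, 0) := by
  have : IsManifold 𝓘(ℝ, E) 1 G := inferInstance
  filter_upwards [tendsto_left.eventually (eventually_differentiableAt_chartMul (E := E) (G := G)),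
    tendsto_right.eventually (eventually_differentiableAt_chartMul (E := E) (G := G)),
    eventually_symm_mem_source (E := E) (G := G)] with x h1 h2 h3
  rw [← derivAt_extChartAt_mul_left h1 h3, ← derivAt_extChartAt_mul_right h2 h3]
  exact derivAt_mul_left_eq _ (mdifferentiableAt_extChartAt h3) X

lemma fderiv_chartMul_one_left (X : E) :
    fderiv ℝ (chartMul E G) (chartOne E G, chartOne E G) (X, 0) = X := by
  have : IsManifold 𝓘(ℝ, E) 1 G := inferInstance
  rw [← derivAt_extChartAt_mul_right ((contDiffAt_chartMul (E := E)).differentiableAt (by simp))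
    (by rw [extChartAt_symm_chartOne]; exact one_mem_chart_source)]
  simp only [extChartAt_symm_chartOne, mul_one]
  have := mfderiv_extChartAt_self (I := 𝓘(ℝ, E)) (x := (1 : G))
  exact congrArg (fun T : E →L[ℝ] E => T X) this

lemma fderiv_chartMul_one_right (X : E) :
    fderiv ℝ (chartMul E G) (chartOne E G, chartOne E G) (0, X) = X := by
  have : IsManifold 𝓘(ℝ, E) 1 G := inferInstance
  rw [← derivAt_extChartAt_mul_left ((contDiffAt_chartMul (E := E)).differentiableAt (by simp))
    (by rw [extChartAt_symm_chartOne]; exact one_mem_chart_source)]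
  simp only [extChartAt_symm_chartOne, one_mul]
  have := mfderiv_extChartAt_self (I := 𝓘(ℝ, E)) (x := (1 : G))
  exact congrArg (fun T : E →L[ℝ] E => T X) this

lemma contDiffAt_fderiv_chartMul :
    ContDiffAt ℝ ∞ (fderiv ℝ (chartMul E G)) (chartOne E G, chartOne E G) :=
  (contDiffAt_chartMul (E := E)).fderiv_right (by simp)

variable [CompleteSpace E]

variable (G) in
/-- `Ad` is smooth near the identity. -/
lemma contDiffAt_adjoint_chart (X : E) :
    ContDiffAt ℝ ∞ (fun x : E => adjointModel ((extChartAt 𝓘(ℝ, E) (1 : G)).symm x) X)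
      (chartOne E G) := by
  -- `M x` is the partial derivative in the first variable at `(e, x)`. It is the identity at `x =
  -- e`, hence invertible nearby, and the chart equation can be solved for `Ad` by the smooth
  -- operator inverse.
  let M : E → E →L[ℝ] E := fun x =>
    (fderiv ℝ (chartMul E G) (chartOne E G, x)).comp (ContinuousLinearMap.inl ℝ E E)
  have hM : ContDiffAt ℝ ∞ M (chartOne E G) := by
    have : ContDiffAt ℝ ∞ (fun x => fderiv ℝ (chartMul E G) (chartOne E G, x)) (chartOne E G) :=
      ContDiffAt.comp (f := fun x => (chartOne E G, x)) (chartOne E G) contDiffAt_fderiv_chartMul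
        (contDiffAt_const.prodMk contDiffAt_id)
    exact this.clm_comp contDiffAt_const
  have hM1 : M (chartOne E G) = ContinuousLinearMap.id ℝ E := by
    ext X; exact fderiv_chartMul_one_left X
  have hinv : (M (chartOne E G)).IsInvertible := by
    rw [hM1]; exact ⟨ContinuousLinearEquiv.refl ℝ E, rfl⟩
  have hev : ∀ᶠ x in 𝓝 (chartOne E G), (M x).IsInvertible :=
    hM.continuousAt.eventually (ContinuousLinearEquiv.isOpen.mem_nhds hinv)
  have hP : ContDiffAt ℝ ∞ (fun x => fderiv ℝ (chartMul E G) (x, chartOne E G) (0, X))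
      (chartOne E G) := by
    have : ContDiffAt ℝ ∞ (fun x => fderiv ℝ (chartMul E G) (x, chartOne E G)) (chartOne E G) :=
      ContDiffAt.comp (f := fun x => (x, chartOne E G)) (chartOne E G) contDiffAt_fderiv_chartMul
        (contDiffAt_id.prodMk contDiffAt_const)
    exact this.clm_apply contDiffAt_const
  refine ((hinv.contDiffAt_map_inverse.comp _ hM).clm_apply hP).congr_of_eventuallyEq ?_
  filter_upwards [hev, eventually_fderiv_chartMul_eq (G := G) X] with x h1 h2
  rw [h2]
  exact (h1.inverse_apply_self _).symm

-- Differentiate `∂₂m(x, e) X = ∂₁m(e, x) (Ad x X)` at `x = e` in the direction `A`, with `m` the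
-- chart multiplication. The right side contributes the derivative of `Ad` plus `D²m ((0, A), (X,
-- 0))`, which symmetry of `D²m` identifies with the second term of the conclusion.
variable (G) in
lemma fderiv_adjoint_chart (A X : E) :
    fderiv ℝ (fun x : E => adjointModel ((extChartAt 𝓘(ℝ, E) (1 : G)).symm x) X) (chartOne E G) A
    = fderiv ℝ (fun x => fderiv ℝ (chartMul E G) (x, chartOne E G) (0, X)) (chartOne E G) A
      - fderiv ℝ (fun x => fderiv ℝ (chartMul E G) (x, chartOne E G) (0, A)) (chartOne E G) X := by
  have hD : HasFDerivAt (fderiv ℝ (chartMul E G))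
      (fderiv ℝ (fderiv ℝ (chartMul E G)) (chartOne E G, chartOne E G))
      (chartOne E G, chartOne E G) :=
    ((contDiffAt_fderiv_chartMul (E := E) (G := G)).differentiableAt (by simp)).hasFDerivAt
  have hl := fun Y : E =>
    (hD.comp (f := fun e => (e, chartOne E G)) _ (hasFDerivAt_prodMk_left _ _)).clm_apply
      (hasFDerivAt_const ((0 : E), Y) _)
  have hAd := ((contDiffAt_adjoint_chart G X).differentiableAt (by simp)).hasFDerivAt
  have hr := (hD.comp (f := fun e => (chartOne E G, e)) _
    (hasFDerivAt_prodMk_right _ _)).clm_apply (hAd.prodMk (hasFDerivAt_const (0 : E) _))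
  have heq := (hl X).unique (hr.congr_of_eventuallyEq (eventually_fderiv_chartMul_eq (G := G) X))
  have hsymm := (contDiffAt_chartMul (E := E) (G := G)).isSymmSndFDerivAt
    (by rw [minSmoothness_of_isRCLikeNormedField]; exact WithTop.coe_le_coe.2 le_top)
    (X, 0) (0, A)
  have h1 := congrArg (fun T : E →L[ℝ] E => T A) heq
  have e1 := (hl X).fderiv
  have e2 := (hl A).fderiv
  have hA1 : adjointModel ((extChartAt 𝓘(ℝ, E) (1 : G)).symm (chartOne E G)) X = X := by
    rw [extChartAt_symm_chartOne, adjointModel_one]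
  simp only [Function.comp_def] at e1 e2
  rw [e1, e2]
  rw [hA1] at h1
  generalize fderiv ℝ (fun x : E => adjointModel ((extChartAt 𝓘(ℝ, E) (1 : G)).symm x) X)
    (chartOne E G) = D at h1 ⊢
  simp only [Function.comp_apply, add_apply, ContinuousLinearMap.comp_apply, zero_apply,
    map_zero, zero_add, ContinuousLinearMap.flip_apply, ContinuousLinearMap.inl_apply,
    ContinuousLinearMap.inr_apply, ContinuousLinearMap.prod_apply,
    fderiv_chartMul_one_left] at h1 ⊢
  rw [h1, hsymm]
  abel

/-- The invariant vector fields, read in the chart at the identity. -/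
lemma mpullbackWithin_mulInvariantVectorField_eventuallyEq (X : E) :
    (fun x : E => (VectorField.mpullbackWithin 𝓘(ℝ, E) 𝓘(ℝ, E)
        (extChartAt 𝓘(ℝ, E) (1 : G)).symm
        (mulInvariantVectorField (I := 𝓘(ℝ, E)) (G := G) X) (Set.range 𝓘(ℝ, E)) x : E))
      =ᶠ[𝓝 (chartOne E G)] fun x => fderiv ℝ (chartMul E G) (x, chartOne E G) (0, X) := by
  have : IsManifold 𝓘(ℝ, E) 1 G := inferInstance
  filter_upwards [tendsto_left.eventually
    (eventually_differentiableAt_chartMul (E := E) (G := G)),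
    eventually_symm_mem_source (E := E) (G := G),
    extChartAt_target_mem_nhds_chartOne (E := E) (G := G)] with x h1 h2 h3
  rw [← derivAt_extChartAt_mul_left h1 h2]
  rw [VectorField.mpullbackWithin_apply, ContinuousLinearMap.inverse_eq
    (mfderivWithin_extChartAt_symm_comp_mfderiv_extChartAt h3)
    (mfderiv_extChartAt_comp_mfderivWithin_extChartAt_symm h3)]
  have := mfderiv_comp_of_eq (I := 𝓘(ℝ, E)) (I' := 𝓘(ℝ, E)) (I'' := 𝓘(ℝ, E)) (x := (1 : G))
    (mdifferentiableAt_extChartAt h2)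
    (mdifferentiable_mul_left (E := E) ((extChartAt 𝓘(ℝ, E) (1 : G)).symm x) 1) (mul_one _)
  have aux : ∀ y : G, (extChartAt 𝓘(ℝ, E) (1 : G)).symm x = y →
      derivAt (E := E) (extChartAt 𝓘(ℝ, E) (1 : G)) ((extChartAt 𝓘(ℝ, E) (1 : G)).symm x)
        = derivAt (extChartAt 𝓘(ℝ, E) (1 : G)) y := by
    rintro _ rfl; rfl
  have h4 := congrArg (fun T : E →L[ℝ] E => T X) this
  refine Eq.trans ?_ h4.symm
  exact congrArg (fun T : E →L[ℝ] E => T _) (aux _ (mul_one _).symm)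

/-- The Lie bracket, in terms of the multiplication read in the chart. -/
lemma bracketModel_eq_chartMul (A X : E) :
    bracketModel G A X =
      fderiv ℝ (fun x => fderiv ℝ (chartMul E G) (x, chartOne E G) (0, X)) (chartOne E G) A
      - fderiv ℝ (fun x => fderiv ℝ (chartMul E G) (x, chartOne E G) (0, A))
        (chartOne E G) X := by
  have : IsManifold 𝓘(ℝ, E) 1 G := inferInstance
  let V : E → E → E := fun X => VectorField.mpullbackWithin 𝓘(ℝ, E) 𝓘(ℝ, E)
    (extChartAt 𝓘(ℝ, E) (1 : G)).symm (mulInvariantVectorField (I := 𝓘(ℝ, E)) (G := G) X)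
    (Set.range 𝓘(ℝ, E))
  have key : ∀ X : E, V X =ᶠ[𝓝 (chartOne E G)]
      fun x => fderiv ℝ (chartMul E G) (x, chartOne E G) (0, X) :=
    mpullbackWithin_mulInvariantVectorField_eventuallyEq
  have hV : ∀ X : E, V X (chartOne E G) = X := fun X =>
    (key X).eq_of_nhds.trans (fderiv_chartMul_one_right (G := G) X)
  -- By definition the bracket is that of the invariant fields read in the chart, pulled back by the
  -- derivative of the chart, which is the identity at `1`.
  have h : bracketModel G A X = (mfderiv 𝓘(ℝ, E) 𝓘(ℝ, E) (extChartAt 𝓘(ℝ, E) (1 : G)) 1).inverse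
      (VectorField.lieBracketWithin (E := E) ℝ (V A) (V X)
        ((extChartAt 𝓘(ℝ, E) (1 : G)).symm ⁻¹' Set.univ ∩ Set.range 𝓘(ℝ, E)) (chartOne E G)) := rfl
  rw [h, mfderiv_extChartAt_self, ← (key X).fderiv_eq, ← (key A).fderiv_eq]
  change (ContinuousLinearMap.id ℝ E).inverse (VectorField.lieBracketWithin ℝ (V A) (V X)
    ((extChartAt 𝓘(ℝ, E) (1 : G)).symm ⁻¹' Set.univ ∩ Set.range 𝓘(ℝ, E)) (chartOne E G)) = _
  rw [ContinuousLinearMap.inverse_id, VectorField.lieBracketWithin, hV, hV]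
  simp only [Set.preimage_univ, Set.univ_inter, modelWithCornersSelf_coe, Set.range_id,
    fderivWithin_univ]
  rfl

/-- `Ad` is smooth near the identity. -/
lemma contMDiffAt_adjointModel_one (X : E) :
    ContMDiffAt 𝓘(ℝ, E) 𝓘(ℝ, E) ∞ (fun g : G => adjointModel g X) 1 := by
  have : IsManifold 𝓘(ℝ, E) ∞ G := inferInstance
  have h := (contDiffAt_adjoint_chart G X).contMDiffAt.comp (I' := 𝓘(ℝ, E)) (1 : G)
    (contMDiffAt_extChartAt (I := 𝓘(ℝ, E)) (n := ∞))
  refine h.congr_of_eventuallyEq ?_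
  filter_upwards [extChartAt_source_mem_nhds (I := 𝓘(ℝ, E)) (1 : G)] with g hg
  simp only [Function.comp_apply, (extChartAt 𝓘(ℝ, E) (1 : G)).left_inv hg]

/-- `Ad` is smooth. -/
lemma contMDiff_adjointModel (X : E) :
    ContMDiff 𝓘(ℝ, E) 𝓘(ℝ, E) ∞ (fun g : G => adjointModel g X) := by
  intro g
  -- Smoothness spreads from `1` to `g` through `Ad x = Ad g ∘ Ad (g⁻¹ x)`.
  have h0 : ContMDiffAt 𝓘(ℝ, E) 𝓘(ℝ, E) ∞ (fun x : G => adjointModel x X) (g⁻¹ * g) := by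
    rw [inv_mul_cancel]; exact contMDiffAt_adjointModel_one X
  have h1 : ContMDiffAt 𝓘(ℝ, E) 𝓘(ℝ, E) ∞ (fun x : G => adjointModel (g⁻¹ * x) X) g :=
    ContMDiffAt.comp (I' := 𝓘(ℝ, E)) g h0 contMDiff_mul_left.contMDiffAt
  have h2 := ((adjointModel (E := E) g).contDiff.contMDiff.contMDiffAt).comp g h1
  refine h2.congr_of_eventuallyEq (Eventually.of_forall fun x => ?_)
  simp only [Function.comp_apply]
  rw [← adjointModel_mul, mul_inv_cancel_left]

/-- The derivative of `Ad` at the identity is `ad`. -/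
lemma derivAt_adjointModel_one (A X : E) :
    derivAt (fun g : G => adjointModel g X) 1 A = bracketModel G A X := by
  rw [derivAt_one_eq_fderiv ((contMDiff_adjointModel (E := E) X).mdifferentiable (by simp) 1),
    bracketModel_eq_chartMul, ← fderiv_adjoint_chart]
  rfl

end AdjointCalculus
-- Left invariant derivatives and integration by parts.
section LeftDeriv

set_option linter.unusedSectionVars false

open Filter Topology MeasureTheory

variable {F : Type*} [NormedAddCommGroup F] [NormedSpace ℝ F]
  {K : Type*} [TopologicalSpace K] [ChartedSpace F K] [Group K]

lemma leftDeriv_add_left (X Y : GroupLieAlgebra 𝓘(ℝ, F) K) (f : K → ℝ) :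
    leftDeriv (X + Y) f = leftDeriv X f + leftDeriv Y f := by
  ext g
  simp only [leftDeriv, mulInvariantVectorField_add, Pi.add_apply, map_add]
  rfl

lemma leftDeriv_smul_left (c : ℝ) (X : GroupLieAlgebra 𝓘(ℝ, F) K) (f : K → ℝ) :
    leftDeriv (c • X) f = c • leftDeriv X f := by
  ext g
  simp only [leftDeriv, mulInvariantVectorField_smul, Pi.smul_apply, map_smul]
  rfl

lemma leftDeriv_zero_left (f : K → ℝ) :
    leftDeriv (0 : GroupLieAlgebra 𝓘(ℝ, F) K) f = 0 := by
  simpa using leftDeriv_smul_left 0 (0 : GroupLieAlgebra 𝓘(ℝ, F) K) f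

lemma leftDeriv_add {f₁ f₂ : K → ℝ} (h₁ : MDifferentiable 𝓘(ℝ, F) 𝓘(ℝ, ℝ) f₁)
    (h₂ : MDifferentiable 𝓘(ℝ, F) 𝓘(ℝ, ℝ) f₂) (X : GroupLieAlgebra 𝓘(ℝ, F) K) :
    leftDeriv X (f₁ + f₂) = leftDeriv X f₁ + leftDeriv X f₂ := by
  ext g
  have := ((h₁ g).hasMFDerivAt.add (h₂ g).hasMFDerivAt).mfderiv
  simp only [leftDeriv, this, Pi.add_apply]
  rfl

lemma leftDeriv_const_smul {f : K → ℝ} (h : MDifferentiable 𝓘(ℝ, F) 𝓘(ℝ, ℝ) f) (c : ℝ)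
    (X : GroupLieAlgebra 𝓘(ℝ, F) K) :
    leftDeriv X (c • f) = c • leftDeriv X f := by
  ext g
  have := ((h g).hasMFDerivAt.const_smul c).mfderiv
  simp only [leftDeriv, this, Pi.smul_apply]
  rfl

lemma leftDeriv_mul {f₁ f₂ : K → ℝ} (h₁ : MDifferentiable 𝓘(ℝ, F) 𝓘(ℝ, ℝ) f₁)
    (h₂ : MDifferentiable 𝓘(ℝ, F) 𝓘(ℝ, ℝ) f₂) (X : GroupLieAlgebra 𝓘(ℝ, F) K) (g : K) :
    leftDeriv X (f₁ * f₂) g = leftDeriv X f₁ g * f₂ g + f₁ g * leftDeriv X f₂ g := by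
  have := ((h₁ g).hasMFDerivAt.mul (h₂ g).hasMFDerivAt).mfderiv
  simp only [leftDeriv, this]
  change f₁ g * leftDeriv X f₂ g + f₂ g * leftDeriv X f₁ g
    = leftDeriv X f₁ g * f₂ g + f₁ g * leftDeriv X f₂ g
  ring

variable [LieGroup 𝓘(ℝ, F) ∞ K]

lemma leftDeriv_eq_derivAt {f : K → ℝ} {g : K} (hf : MDifferentiableAt 𝓘(ℝ, F) 𝓘(ℝ, ℝ) f g)
    (X : GroupLieAlgebra 𝓘(ℝ, F) K) :
    leftDeriv X f g = derivAt (E := F) (fun x => f (g * x)) 1 X := by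
  have := mfderiv_comp_of_eq (I := 𝓘(ℝ, F)) (I' := 𝓘(ℝ, F)) (I'' := 𝓘(ℝ, ℝ)) (x := (1 : K))
    hf (mdifferentiable_mul_left (E := F) g 1) (mul_one g)
  have aux : ∀ y : K, g = y → derivAt (E := F) f g = derivAt f y := by rintro _ rfl; rfl
  have h := congrArg (fun T : F →L[ℝ] ℝ => T X) this
  refine Eq.trans ?_ h.symm
  exact congrArg (fun T : F →L[ℝ] ℝ => T _) (aux _ (mul_one g).symm)

lemma leftDeriv_comp_mul_left {f : K → ℝ} (hf : MDifferentiable 𝓘(ℝ, F) 𝓘(ℝ, ℝ) f) (g h : K)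
    (X : GroupLieAlgebra 𝓘(ℝ, F) K) :
    leftDeriv X (fun x => f (g * x)) h = leftDeriv X f (g * h) := by
  have hg : MDifferentiableAt 𝓘(ℝ, F) 𝓘(ℝ, ℝ) (fun x => f (g * x)) h :=
    MDifferentiableAt.comp (I' := 𝓘(ℝ, F)) h (hf _) (mdifferentiable_mul_left g h)
  rw [leftDeriv_eq_derivAt hg, leftDeriv_eq_derivAt (hf _)]
  simp only [mul_assoc]

/-- The derivative is the fibre component of the tangent map of `f` composed with the field, so one
order is lost; `m ≤ 2` is the regularity taken from `contMDiff_mulInvariantVectorField`. -/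
lemma contMDiff_leftDeriv {m n : WithTop ℕ∞} {f : K → ℝ} (hf : ContMDiff 𝓘(ℝ, F) 𝓘(ℝ, ℝ) n f)
    (hmn : m + 1 ≤ n) (hm : m ≤ 2) (X : GroupLieAlgebra 𝓘(ℝ, F) K) :
    ContMDiff 𝓘(ℝ, F) 𝓘(ℝ, ℝ) m (leftDeriv X f) := by
  have : IsManifold 𝓘(ℝ, F) 1 K := inferInstance
  have h1 := hf.contMDiff_tangentMap hmn
  have h2 := (contMDiff_mulInvariantVectorField (I := 𝓘(ℝ, F)) (G := K) X).of_le (m := m)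
    (by rwa [minSmoothness_of_isRCLikeNormedField])
  exact (contMDiff_snd_tangentBundle_modelSpace ℝ 𝓘(ℝ, ℝ)).comp (h1.comp h2)

lemma continuous_leftDeriv {f : K → ℝ} (hf : ContMDiff 𝓘(ℝ, F) 𝓘(ℝ, ℝ) 1 f)
    (X : GroupLieAlgebra 𝓘(ℝ, F) K) : Continuous (leftDeriv X f) :=
  (contMDiff_leftDeriv (m := 0) hf (by simp) (by simp) X).continuous

/-- A function on a connected group whose left invariant derivatives all vanish is constant. -/
lemma eq_of_leftDeriv_eq_zero [PreconnectedSpace K] {f : K → ℝ}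
    (hf : MDifferentiable 𝓘(ℝ, F) 𝓘(ℝ, ℝ) f)
    (h0 : ∀ (X : GroupLieAlgebra 𝓘(ℝ, F) K) (g : K), leftDeriv X f g = 0) (x y : K) :
    f x = f y := by
  have : IsManifold 𝓘(ℝ, F) 1 K := inferInstance
  -- Every tangent vector at `g` is the value there of an invariant field; pull it back to `1` by
  -- writing `f = (f ∘ L_g) ∘ L_{g⁻¹}`.
  have hd : ∀ g, derivAt (E := F) f g = 0 := by
    intro g
    ext v
    have e : (fun x => f (g * (g⁻¹ * x))) = f := by ext; simp
    have h1 : MDifferentiableAt 𝓘(ℝ, F) 𝓘(ℝ, ℝ) (fun x => f (g * x)) 1 :=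
      MDifferentiableAt.comp (I' := 𝓘(ℝ, F)) 1 (hf _) (mdifferentiable_mul_left g 1)
    have := mfderiv_comp_of_eq (I := 𝓘(ℝ, F)) (I' := 𝓘(ℝ, F)) (I'' := 𝓘(ℝ, ℝ)) (x := g)
      h1 (mdifferentiable_mul_left (E := F) g⁻¹ g) (inv_mul_cancel g)
    have e' : (fun x => f (g * x)) ∘ (fun x => g⁻¹ * x) = f := e
    rw [e'] at this
    have aux : ∀ y : K, y = 1 → derivAt (E := F) (fun x => f (g * x)) y
        = derivAt (fun x => f (g * x)) 1 := by rintro _ rfl; rfl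
    have h2 := congrArg (fun T : F →L[ℝ] ℝ => T v) this
    refine h2.trans ((congrArg (fun T : F →L[ℝ] ℝ => T _) (aux _ (inv_mul_cancel g))).trans ?_)
    exact (leftDeriv_eq_derivAt (hf g) _).symm.trans (h0 _ g)
  have hloc : IsLocallyConstant f := by
    rw [IsLocallyConstant.iff_eventually_eq]
    intro x
    let φ := extChartAt 𝓘(ℝ, F) x
    obtain ⟨ε, hε, hball⟩ := Metric.mem_nhds_iff.1 (extChartAt_target_mem_nhds (I := 𝓘(ℝ, F)) x)
    have hder : ∀ y ∈ Metric.ball (φ x) ε, HasFDerivAt (f ∘ φ.symm) (0 : F →L[ℝ] ℝ) y := by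
      intro y hy
      have h1 : MDifferentiableAt 𝓘(ℝ, F) 𝓘(ℝ, F) φ.symm y :=
        ((contMDiffOn_extChartAt_symm (n := 1) x).contMDiffAt
          (mem_of_superset (Metric.isOpen_ball.mem_nhds hy) hball)).mdifferentiableAt (by simp)
      have h2 := HasMFDerivAt.comp (I := 𝓘(ℝ, F)) (I' := 𝓘(ℝ, F)) (I'' := 𝓘(ℝ, ℝ)) y
        (hf (φ.symm y)).hasMFDerivAt h1.hasMFDerivAt
      have h3 := hasMFDerivAt_iff_hasFDerivAt.1 h2
      refine h3.congr_fderiv ?_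
      ext v
      change derivAt (E := F) f (φ.symm y) (mfderiv 𝓘(ℝ, F) 𝓘(ℝ, F) φ.symm y v) = 0
      rw [hd]
      rfl
    have hconst : ∀ y ∈ Metric.ball (φ x) ε, (f ∘ φ.symm) y = (f ∘ φ.symm) (φ x) := by
      intro y hy
      refine (convex_ball (φ x) ε).is_const_of_fderivWithin_eq_zero (𝕜 := ℝ)
        (fun z hz => (hder z hz).differentiableAt.differentiableWithinAt) (fun z hz => ?_) hy
        (Metric.mem_ball_self hε)
      exact (hder z hz).hasFDerivWithinAt.fderivWithin
        (Metric.isOpen_ball.uniqueDiffWithinAt hz)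
    filter_upwards [extChartAt_source_mem_nhds (I := 𝓘(ℝ, F)) x,
      (continuousAt_extChartAt (I := 𝓘(ℝ, F)) x).preimage_mem_nhds (Metric.ball_mem_nhds _ hε)]
      with y hy hy'
    have := hconst _ hy'
    simpa only [Function.comp_apply, φ, (extChartAt 𝓘(ℝ, F) x).left_inv hy,
      extChartAt_to_inv] using this
  exact hloc.apply_eq_of_isPreconnected isPreconnected_univ (Set.mem_univ x) (Set.mem_univ y)

/-- The left invariant derivative of a `C¹` function on a compact group has mean zero for a right
invariant measure. -/
lemma integral_leftDeriv_eq_zero [CompleteSpace F] [CompactSpace K] [MeasurableSpace K]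
    [BorelSpace K] (μ : Measure K) [IsFiniteMeasure μ] [μ.IsMulRightInvariant] {f : K → ℝ}
    (hf : ContMDiff 𝓘(ℝ, F) 𝓘(ℝ, ℝ) 1 f) (X : GroupLieAlgebra 𝓘(ℝ, F) K) :
    ∫ g, leftDeriv X f g ∂μ = 0 := by
  have : IsManifold 𝓘(ℝ, F) 1 K := inferInstance
  have : IsTopologicalGroup K := topologicalGroup_of_lieGroup 𝓘(ℝ, F) ∞
  have hcont := continuous_leftDeriv hf X
  have hf1 := hf.mdifferentiable (by simp)
  have hX : ContMDiffAt 𝓘(ℝ, F) 𝓘(ℝ, F).tangent 1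
      (fun g => (⟨g, mulInvariantVectorField X g⟩ : TangentBundle 𝓘(ℝ, F) K)) 1 :=
    ((contMDiff_mulInvariantVectorField (I := 𝓘(ℝ, F)) (G := K) X).of_le
      (by rw [minSmoothness_of_isRCLikeNormedField]; norm_num)).contMDiffAt
  -- Left translates of an integral curve `γ` through `1` are integral curves, so `f (g γ(t))` has
  -- derivative `(L_X f)(g γ(t))`. By right invariance `∫ f (g γ(t)) dμ` does not depend on `t`;
  -- differentiate under the integral at `t = 0`.
  obtain ⟨γ, hγ0, hγ⟩ := exists_isMIntegralCurveAt_of_contMDiffAt_boundaryless (0 : ℝ) hX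
  have hder : ∀ᶠ t in 𝓝 (0 : ℝ), ∀ g, HasDerivAt (fun s => f (g * γ s))
      (leftDeriv X f (g * γ t)) t := by
    filter_upwards [hγ] with t ht g
    rw [← leftDeriv_comp_mul_left hf1]
    have h1 : MDifferentiableAt 𝓘(ℝ, F) 𝓘(ℝ, ℝ) (fun x => f (g * x)) (γ t) :=
      MDifferentiableAt.comp (I' := 𝓘(ℝ, F)) (γ t) (hf1 _) (mdifferentiable_mul_left g _)
    have h2 : HasFDerivAt (fun s => f (g * γ s))
        ((derivAt (E := F) (fun x => f (g * x)) (γ t)).comp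
          ((1 : ℝ →L[ℝ] ℝ).smulRight (mulInvariantVectorField X (γ t) : F))) t :=
      hasMFDerivAt_iff_hasFDerivAt.1
        (HasMFDerivAt.comp (I := 𝓘(ℝ, ℝ)) (I' := 𝓘(ℝ, F)) (I'' := 𝓘(ℝ, ℝ))
          (g := fun x => f (g * x)) t h1.hasMFDerivAt ht)
    refine h2.hasDerivAt.congr_deriv ?_
    change derivAt (E := F) _ (γ t) ((1 : ℝ) • (mulInvariantVectorField X (γ t) : F)) = _
    rw [one_smul]
    rfl
  obtain ⟨C, hC⟩ := isCompact_univ.exists_bound_of_continuousOn hcont.continuousOn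
  have hmeas : ∀ t, AEStronglyMeasurable (fun g => f (g * γ t)) μ := fun t =>
    (hf.continuous.comp (continuous_mul_const _)).aestronglyMeasurable
  have hint : Integrable (fun g => f (g * γ 0)) μ :=
    (hf.continuous.comp (continuous_mul_const _)).integrable_of_hasCompactSupport
      (HasCompactSupport.of_compactSpace _)
  have h := (hasDerivAt_integral_of_dominated_loc_of_deriv_le (μ := μ)
    (F := fun t g => f (g * γ t)) (F' := fun t g => leftDeriv X f (g * γ t))
    (bound := fun _ => C) hder (Eventually.of_forall hmeas) hint
    ((hcont.comp (continuous_mul_const _)).aestronglyMeasurable)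
    (Eventually.of_forall fun g t _ => hC _ (Set.mem_univ _)) (integrable_const C)
    (Eventually.of_forall fun g t ht => ht g)).2
  have h1 : (fun t => ∫ g, f (g * γ t) ∂μ) = fun _ => ∫ g, f g ∂μ := by
    ext t; exact integral_mul_right_eq_self f (γ t)
  rw [h1, hγ0] at h
  simpa using h.unique (hasDerivAt_const _ _)

/-- Integration by parts for left invariant derivatives. -/
lemma integral_leftDeriv_mul [CompleteSpace F] [CompactSpace K] [MeasurableSpace K]
    [BorelSpace K] (μ : Measure K) [IsFiniteMeasure μ] [μ.IsMulRightInvariant] {f₁ f₂ : K → ℝ}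
    (h₁ : ContMDiff 𝓘(ℝ, F) 𝓘(ℝ, ℝ) 1 f₁) (h₂ : ContMDiff 𝓘(ℝ, F) 𝓘(ℝ, ℝ) 1 f₂)
    (X : GroupLieAlgebra 𝓘(ℝ, F) K) :
    ∫ g, leftDeriv X f₁ g * f₂ g ∂μ = - ∫ g, f₁ g * leftDeriv X f₂ g ∂μ := by
  have hi : ∀ u : K → ℝ, Continuous u → Integrable u μ := fun u hu =>
    hu.integrable_of_hasCompactSupport (HasCompactSupport.of_compactSpace _)
  have h := integral_leftDeriv_eq_zero μ (h₁.mul h₂) X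
  have e : ∀ g, leftDeriv X (f₁ * f₂) g = leftDeriv X f₁ g * f₂ g + f₁ g * leftDeriv X f₂ g :=
    leftDeriv_mul (h₁.mdifferentiable (by simp)) (h₂.mdifferentiable (by simp)) X
  have h' : ∫ g, leftDeriv X (f₁ * f₂) g ∂μ = 0 := h
  simp only [e] at h'
  rw [integral_add (f := fun g => leftDeriv X f₁ g * f₂ g) (g := fun g => f₁ g * leftDeriv X f₂ g)
    (hi _ ((continuous_leftDeriv h₁ X).mul h₂.continuous))
    (hi _ (h₁.continuous.mul (continuous_leftDeriv h₂ X)))] at h'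
  linarith

/-- The operator `½ ∑ₖ (Aₖ)²` is symmetric. -/
lemma integral_hormanderOp_mul [CompleteSpace F] [CompactSpace K] [MeasurableSpace K]
    [BorelSpace K] (μ : Measure K) [IsFiniteMeasure μ] [μ.IsMulRightInvariant] {f₁ f₂ : K → ℝ}
    (h₁ : ContMDiff 𝓘(ℝ, F) 𝓘(ℝ, ℝ) 2 f₁) (h₂ : ContMDiff 𝓘(ℝ, F) 𝓘(ℝ, ℝ) 2 f₂)
    {N : ℕ} (A : Fin N → GroupLieAlgebra 𝓘(ℝ, F) K) :
    ∫ g, hormanderOp 0 A f₁ g * f₂ g ∂μ = ∫ g, f₁ g * hormanderOp 0 A f₂ g ∂μ := by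
  have hi : ∀ u : K → ℝ, Continuous u → Integrable u μ := fun u hu =>
    hu.integrable_of_hasCompactSupport (HasCompactSupport.of_compactSpace _)
  have l₁ := fun k => contMDiff_leftDeriv (m := 1) h₁ (by norm_num) (by norm_num) (A k)
  have l₂ := fun k => contMDiff_leftDeriv (m := 1) h₂ (by norm_num) (by norm_num) (A k)
  have h₁' := h₁.of_le (m := 1) (by norm_num)
  have h₂' := h₂.of_le (m := 1) (by norm_num)
  simp only [hormanderOp, leftDeriv_zero_left, Pi.zero_apply, add_zero, Finset.mul_sum,
    Finset.sum_mul]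
  rw [integral_finsetSum (f := fun k g => 1 / 2 * leftDeriv (A k) (leftDeriv (A k) f₁) g * f₂ g) _
      fun k _ => hi _ ((continuous_const.mul
        (continuous_leftDeriv (l₁ k) (A k))).mul h₂.continuous),
    integral_finsetSum (f := fun k g => f₁ g * (1 / 2 * leftDeriv (A k) (leftDeriv (A k) f₂) g)) _
      fun k _ => hi _ (h₁.continuous.mul (continuous_const.mul
        (continuous_leftDeriv (l₂ k) (A k))))]
  refine Finset.sum_congr rfl fun k _ => ?_
  have e := (integral_leftDeriv_mul μ (l₁ k) h₂' (A k)).trans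
    (by rw [integral_leftDeriv_mul μ h₁' (l₂ k) (A k), neg_neg])
  simp only [mul_assoc, mul_left_comm _ (1 / 2 : ℝ), integral_const_mul]
  rw [e]

end LeftDeriv
-- Parseval's identity and independence of the orthonormal basis.
section OrthonormalBasis

set_option linter.unusedSectionVars false

variable {E : Type*} [NormedAddCommGroup E] [NormedSpace ℝ E]
  {G : Type*} [TopologicalSpace G] [ChartedSpace E G] [Group G]
  {B : LinearMap.BilinForm ℝ (GroupLieAlgebra 𝓘(ℝ, E) G)}
  {V : Submodule ℝ (GroupLieAlgebra 𝓘(ℝ, E) G)} {d : ℕ}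
  {Y Z : Fin d → GroupLieAlgebra 𝓘(ℝ, E) G}

lemma IsOrthonormalBasisOf.mem (hY : IsOrthonormalBasisOf B V Y) (i : Fin d) : Y i ∈ V :=
  hY.span_eq ▸ Submodule.subset_span (Set.mem_range_self i)

lemma IsOrthonormalBasisOf.sum_smul_eq (hY : IsOrthonormalBasisOf B V Y)
    {X : GroupLieAlgebra 𝓘(ℝ, E) G} (hX : X ∈ V) : ∑ i, B X (Y i) • Y i = X := by
  rw [← hY.span_eq] at hX
  obtain ⟨c, rfl⟩ := (Submodule.mem_span_range_iff_exists_fun ℝ).1 hX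
  refine Finset.sum_congr rfl fun i _ => ?_
  simp [LinearMap.sum_apply, hY.orthonormal]

/-- Parseval's identity; only one of the two vectors has to lie in `V`. -/
lemma IsOrthonormalBasisOf.sum_mul_eq (hY : IsOrthonormalBasisOf B V Y)
    (hs : ∀ X X', B X X' = B X' X) {X : GroupLieAlgebra 𝓘(ℝ, E) G} (hX : X ∈ V)
    (X' : GroupLieAlgebra 𝓘(ℝ, E) G) : ∑ i, B X (Y i) * B X' (Y i) = B X X' := by
  conv_rhs => rw [← hY.sum_smul_eq hX]
  simp [LinearMap.sum_apply, hs X']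

lemma IsOrthonormalBasisOf.linearIndependent (hY : IsOrthonormalBasisOf B V Y) :
    LinearIndependent ℝ Y := by
  rw [Fintype.linearIndependent_iff]
  intro c hc i
  have : B (∑ j, c j • Y j) (Y i) = 0 := by rw [hc]; simp
  simpa [LinearMap.sum_apply, hY.orthonormal] using this

lemma IsOrthonormalBasisOf.finrank_eq (hY : IsOrthonormalBasisOf B V Y) :
    Module.finrank ℝ V = d := by
  rw [← hY.span_eq, finrank_span_eq_card hY.linearIndependent, Fintype.card_fin]

/-- The trace of a bilinear form over an orthonormal basis does not depend on the basis. -/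
lemma IsOrthonormalBasisOf.sum_bilin_eq (hY : IsOrthonormalBasisOf B V Y)
    (hZ : IsOrthonormalBasisOf B V Z) (hs : ∀ X X', B X X' = B X' X)
    (D : LinearMap.BilinForm ℝ (GroupLieAlgebra 𝓘(ℝ, E) G)) :
    ∑ i, D (Y i) (Y i) = ∑ i, D (Z i) (Z i) := by
  have h : ∀ j, D (Z j) (Z j)
      = ∑ i, ∑ k, (B (Y i) (Z j) * B (Y k) (Z j)) * D (Y i) (Y k) := by
    intro j
    conv_lhs => rw [← hY.sum_smul_eq (hZ.mem j)]
    simp only [map_sum, map_smul, LinearMap.sum_apply, LinearMap.smul_apply, smul_eq_mul,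
      Finset.mul_sum, hs (Z j)]
    rw [Finset.sum_comm]
    refine Finset.sum_congr rfl fun i _ => Finset.sum_congr rfl fun k _ => by ring
  simp only [h]
  rw [Finset.sum_comm]
  refine Finset.sum_congr rfl fun i _ => ?_
  rw [Finset.sum_comm]
  simp only [← Finset.sum_mul, hZ.sum_mul_eq hs (hY.mem i), hY.orthonormal]
  simp

/-- `Δ_V` does not depend on the orthonormal basis. -/
lemma sumSquares_eq [LieGroup 𝓘(ℝ, E) ∞ G] (hY : IsOrthonormalBasisOf B V Y)
    (hZ : IsOrthonormalBasisOf B V Z) (hs : ∀ X X', B X X' = B X' X) {f : G → ℝ}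
    (hf : ContMDiff 𝓘(ℝ, E) 𝓘(ℝ, ℝ) 2 f) (g : G) :
    sumSquares Y f g = sumSquares Z f g := by
  have hd : ∀ X : GroupLieAlgebra 𝓘(ℝ, E) G, MDifferentiable 𝓘(ℝ, E) 𝓘(ℝ, ℝ) (leftDeriv X f) :=
    fun X => (contMDiff_leftDeriv (m := 1) hf (by norm_num) (by norm_num) X).mdifferentiable
      (by simp)
  -- Linearity in the inner field requires the first derivatives of `f` to be differentiable, which
  -- is where `C²` enters.
  let D : LinearMap.BilinForm ℝ (GroupLieAlgebra 𝓘(ℝ, E) G) :=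
    LinearMap.mk₂ ℝ (fun X X' => leftDeriv X (leftDeriv X' f) g)
      (fun X X' W => by rw [leftDeriv_add_left]; rfl)
      (fun c X W => by rw [leftDeriv_smul_left]; rfl)
      (fun X W W' => by rw [leftDeriv_add_left, leftDeriv_add (hd _) (hd _)]; rfl)
      (fun c X W => by rw [leftDeriv_smul_left, leftDeriv_const_smul (hd _)]; rfl)
  exact hY.sum_bilin_eq hZ hs D

end OrthonormalBasis

/-! ### The action of `H` and `𝔥` on the Lie algebra of `G`. -/

section Subgroup

set_option linter.unusedSectionVars false

open Filter Topology MeasureTheory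

variable {E : Type*} [NormedAddCommGroup E] [NormedSpace ℝ E]
  {G : Type*} [TopologicalSpace G] [ChartedSpace E G] [Group G]
  [LieGroup 𝓘(ℝ, E) ∞ G] [CompleteSpace E]
  {F : Type*} [NormedAddCommGroup F] [NormedSpace ℝ F]
  {H : Subgroup G} [ChartedSpace F H]

lemma adjoint_mul_apply (g h : G) (X : GroupLieAlgebra 𝓘(ℝ, E) G) :
    adjoint (g * h) X = adjoint g (adjoint h X) := adjointModel_mul (E := E) g h X

lemma adjoint_one_apply (X : GroupLieAlgebra 𝓘(ℝ, E) G) : adjoint (1 : G) X = X :=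
  adjointModel_one (E := E) X

/-- `h ↦ ℓ (Ad h X)` is smooth on `H`. -/
lemma contMDiff_clm_adjointModel (hHG : IsEmbeddedSubgroup (E := E) (F := F) H)
    {V : Type*} [NormedAddCommGroup V] [NormedSpace ℝ V] (ℓ : E →L[ℝ] V) (X : E) :
    ContMDiff 𝓘(ℝ, F) 𝓘(ℝ, V) ∞ (fun h : H => ℓ (adjointModel (h : G) X)) :=
  ℓ.contDiff.contMDiff.comp ((contMDiff_adjointModel X).comp hHG.smooth)

variable (H) in
/-- `lieIncl` as a map between model spaces. -/
noncomputable def lieInclModel : F →L[ℝ] E := lieIncl (E := E) (F := F) H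

/-- The derivative at the identity of `h ↦ ℓ (Ad h X)` on `H`. -/
lemma derivAt_clm_adjointModel (hHG : IsEmbeddedSubgroup (E := E) (F := F) H)
    {V : Type*} [NormedAddCommGroup V] [NormedSpace ℝ V] (ℓ : E →L[ℝ] V) (X : E)
    (A : F) :
    derivAt (fun h : H => ℓ (adjointModel (h : G) X)) 1 A
      = ℓ (bracketModel G (lieInclModel H A) X) := by
  have h1 : MDifferentiableAt 𝓘(ℝ, E) 𝓘(ℝ, E) (fun g : G => adjointModel (E := E) g X)
      ((1 : H) : G) := (contMDiff_adjointModel X).mdifferentiable (by simp) _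
  have h2 : MDifferentiableAt 𝓘(ℝ, F) 𝓘(ℝ, E) (Subtype.val : H → G) 1 :=
    hHG.smooth.mdifferentiable (by simp) 1
  have h3 := HasMFDerivAt.comp (I := 𝓘(ℝ, F)) (I' := 𝓘(ℝ, E)) (I'' := 𝓘(ℝ, E)) (1 : H)
    h1.hasMFDerivAt h2.hasMFDerivAt
  have h4 := HasMFDerivAt.comp (I := 𝓘(ℝ, F)) (I' := 𝓘(ℝ, E)) (I'' := 𝓘(ℝ, V)) (1 : H)
    (hasMFDerivAt_iff_hasFDerivAt.2 ℓ.hasFDerivAt) h3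
  rw [← derivAt_adjointModel_one]
  exact congrArg (fun T : F →L[ℝ] V => T A) h4.mfderiv

variable [FiniteDimensional ℝ E]

/-- `h ↦ ⟨Ad(h) X, Y⟩` is smooth. -/
lemma contMDiff_adCoeff (hHG : IsEmbeddedSubgroup (E := E) (F := F) H)
    (B : LinearMap.BilinForm ℝ (GroupLieAlgebra 𝓘(ℝ, E) G)) (X Y : GroupLieAlgebra 𝓘(ℝ, E) G) :
    ContMDiff 𝓘(ℝ, F) 𝓘(ℝ, ℝ) ∞ (adCoeff (H := H) B X Y) := by
  let ℓ : E →ₗ[ℝ] ℝ := B.flip Y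
  exact contMDiff_clm_adjointModel hHG ℓ.toContinuousLinearMap X

/-- Since `Ad (h x) = Ad h ∘ Ad x`, differentiating at `x = 1` puts `ad A` next to `X`, inside `Ad
h`. Invariant differential operators on coefficients thereby become linear algebra. -/
lemma leftDeriv_adCoeff [LieGroup 𝓘(ℝ, F) ∞ H] (hHG : IsEmbeddedSubgroup (E := E) (F := F) H)
    (B : LinearMap.BilinForm ℝ (GroupLieAlgebra 𝓘(ℝ, E) G)) (X Y : GroupLieAlgebra 𝓘(ℝ, E) G)
    (A : GroupLieAlgebra 𝓘(ℝ, F) H) :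
    leftDeriv A (adCoeff (H := H) B X Y)
      = adCoeff B ⁅(lieIncl H A : GroupLieAlgebra 𝓘(ℝ, E) G), X⁆ Y := by
  ext h
  let ℓ : E →ₗ[ℝ] ℝ := B.flip Y
  rw [leftDeriv_eq_derivAt ((contMDiff_adCoeff hHG B X Y).mdifferentiable (by simp) h)]
  have := derivAt_clm_adjointModel hHG (ℓ.toContinuousLinearMap.comp (adjointModel (h : G))) X A
  refine Eq.trans ?_ this
  congr 2
  ext x
  change B (adjoint ((h * x : H) : G) X) Y = B (adjoint (h : G) (adjoint (x : G) X)) Y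
  rw [← adjoint_mul_apply]
  rfl

/-- An invariant subspace is stable under `ad A` for `A` in the Lie algebra of `H`. -/
lemma lie_mem_of_isAdInvariant (hHG : IsEmbeddedSubgroup (E := E) (F := F) H)
    {V : Submodule ℝ (GroupLieAlgebra 𝓘(ℝ, E) G)} (hV : IsAdInvariant H V)
    (A : GroupLieAlgebra 𝓘(ℝ, F) H) {X : GroupLieAlgebra 𝓘(ℝ, E) G} (hX : X ∈ V) :
    ⁅(lieIncl H A : GroupLieAlgebra 𝓘(ℝ, E) G), X⁆ ∈ V := by
  by_contra hcon
  -- A functional `f` killing `V` but not `[A, X]` is impossible: `f (Ad h X)` vanishes identically,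
  -- and its derivative at `1` is `f [A, X]`.
  obtain ⟨f, hf, hle⟩ := Submodule.exists_le_ker_of_notMem hcon
  let ℓ : E →ₗ[ℝ] ℝ := f
  have h := derivAt_clm_adjointModel hHG ℓ.toContinuousLinearMap X A
  have h0 : (fun h : H => ℓ.toContinuousLinearMap (adjointModel (h : G) X)) = fun _ => 0 := by
    ext h
    exact hle (hV h h.2 X hX)
  rw [h0] at h
  have h1 : derivAt (E := F) (fun _ : H => (0 : ℝ)) 1 A = 0 :=
    congrArg (fun T : F →L[ℝ] ℝ => T A) (mfderiv_const (I := 𝓘(ℝ, F)) (I' := 𝓘(ℝ, ℝ)))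
  exact hf (h.symm.trans h1)

/-- `Ad h` commutes with `ad A` when `H` is abelian. -/
lemma adjoint_lie_of_comm (hHG : IsEmbeddedSubgroup (E := E) (F := F) H)
    (hc : ∀ x ∈ H, ∀ y ∈ H, x * y = y * x) (A : GroupLieAlgebra 𝓘(ℝ, F) H) (h : H)
    (X : GroupLieAlgebra 𝓘(ℝ, E) G) :
    adjoint (h : G) ⁅(lieIncl H A : GroupLieAlgebra 𝓘(ℝ, E) G), X⁆
      = ⁅(lieIncl H A : GroupLieAlgebra 𝓘(ℝ, E) G), adjoint (h : G) X⁆ := by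
  -- Both sides are derivatives at `x = 1` of `Ad h (Ad x X) = Ad x (Ad h X)`.
  have h1 := derivAt_clm_adjointModel hHG (adjointModel (h : G)) X A
  have h2 := derivAt_clm_adjointModel hHG (ContinuousLinearMap.id ℝ E) (adjointModel (h : G) X) A
  refine h1.symm.trans (Eq.trans ?_ h2)
  congr 2
  ext x
  exact (adjointModel_mul (E := E) _ _ X).symm.trans
    ((congrArg (fun g => adjointModel (E := E) g X) (hc _ h.2 _ x.2)).trans
      (adjointModel_mul (E := E) _ _ X))

/-- `ad A` is skew for an invariant inner product. -/
lemma IsAdInvariantInner.lie_skew {B : LinearMap.BilinForm ℝ (GroupLieAlgebra 𝓘(ℝ, E) G)}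
    (hB : IsAdInvariantInner H B) (hHG : IsEmbeddedSubgroup (E := E) (F := F) H)
    (A : GroupLieAlgebra 𝓘(ℝ, F) H) (X Y : GroupLieAlgebra 𝓘(ℝ, E) G) :
    B ⁅(lieIncl H A : GroupLieAlgebra 𝓘(ℝ, E) G), X⁆ Y
      = - B X ⁅(lieIncl H A : GroupLieAlgebra 𝓘(ℝ, E) G), Y⁆ := by
  let a : F := A
  let B₁ : E →ₗ[ℝ] E →ₗ[ℝ] ℝ := B
  let B₂ : E →L[ℝ] E →L[ℝ] ℝ :=
    ((LinearMap.toContinuousLinearMap (𝕜 := ℝ) (E := E) (F' := ℝ)).toLinearMap ∘ₗ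
      B₁).toContinuousLinearMap
  let w : E → H → E := fun X h => ContinuousLinearMap.id ℝ E (adjointModel (h : G) X)
  have hw : ∀ X : E, HasFDerivAt (w X ∘ (extChartAt 𝓘(ℝ, F) (1 : H)).symm)
      (derivAt (w X) 1) (chartOne F H) :=
    fun X => hasFDerivAt_comp_extChartAt_symm
      ((contMDiff_clm_adjointModel hHG (ContinuousLinearMap.id ℝ E) X).mdifferentiable (by simp) 1)
  -- Product rule for the constant function `B (Ad h X) (Ad h Y)`.
  have h := B₂.hasFDerivAt_of_bilinear (hw X) (hw Y)
  have hconst : (fun y => B₂ ((w X ∘ (extChartAt 𝓘(ℝ, F) (1 : H)).symm) y)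
      ((w Y ∘ (extChartAt 𝓘(ℝ, F) (1 : H)).symm) y)) = fun _ => B X Y := by
    ext y
    exact hB.invariant _ (((extChartAt 𝓘(ℝ, F) (1 : H)).symm y)).2 X Y
  rw [hconst] at h
  have h1 := congrArg (fun T : F →L[ℝ] ℝ => T a) (h.unique (hasFDerivAt_const _ _))
  have e : ∀ X : E, (w X ∘ (extChartAt 𝓘(ℝ, F) (1 : H)).symm) (chartOne F H) = X := by
    intro X
    simp only [Function.comp_apply, extChartAt_symm_chartOne, w]
    exact adjointModel_one (E := E) X
  have e' : ∀ X : E, derivAt (w X) 1 a = bracketModel G (lieInclModel H a) X :=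
    fun X => derivAt_clm_adjointModel hHG (ContinuousLinearMap.id ℝ E) X a
  have h2 : B₂ ((w X ∘ (extChartAt 𝓘(ℝ, F) (1 : H)).symm) (chartOne F H))
        (derivAt (w Y) 1 a) + B₂ (derivAt (w X) 1 a)
        ((w Y ∘ (extChartAt 𝓘(ℝ, F) (1 : H)).symm) (chartOne F H)) = 0 := h1
  rw [e' X, e' Y, e X, e Y] at h2
  have h3 : B X ⁅(lieIncl H A : GroupLieAlgebra 𝓘(ℝ, E) G), Y⁆
    + B ⁅(lieIncl H A : GroupLieAlgebra 𝓘(ℝ, E) G), X⁆ Y = 0 := h2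
  linarith

lemma hormanderOp_adCoeff [LieGroup 𝓘(ℝ, F) ∞ H] (hHG : IsEmbeddedSubgroup (E := E) (F := F) H)
    (B : LinearMap.BilinForm ℝ (GroupLieAlgebra 𝓘(ℝ, E) G)) (X Y : GroupLieAlgebra 𝓘(ℝ, E) G)
    {N : ℕ} (A : Fin N → GroupLieAlgebra 𝓘(ℝ, F) H) :
    hormanderOp 0 A (adCoeff (H := H) B X Y)
      = adCoeff B ((1 / 2 : ℝ) • ∑ k, ⁅(lieIncl H (A k) : GroupLieAlgebra 𝓘(ℝ, E) G),
          ⁅(lieIncl H (A k) : GroupLieAlgebra 𝓘(ℝ, E) G), X⁆⁆) Y := by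
  ext h
  rw [hormanderOp, leftDeriv_zero_left]
  simp only [leftDeriv_adCoeff hHG, adCoeff, Pi.zero_apply, add_zero, map_smul, map_sum, LinearMap.smul_apply, LinearMap.sum_apply, smul_eq_mul]

/-- A vector annihilated by `ad 𝔥` is fixed by `H`, if `H` is connected. -/
lemma adjoint_eq_self_of_lie_eq_zero [LieGroup 𝓘(ℝ, F) ∞ H] [PreconnectedSpace H]
    (hHG : IsEmbeddedSubgroup (E := E) (F := F) H)
    {B : LinearMap.BilinForm ℝ (GroupLieAlgebra 𝓘(ℝ, E) G)} (hB : IsAdInvariantInner H B)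
    {X : GroupLieAlgebra 𝓘(ℝ, E) G}
    (hX : ∀ A : GroupLieAlgebra 𝓘(ℝ, F) H,
      ⁅(lieIncl H A : GroupLieAlgebra 𝓘(ℝ, E) G), X⁆ = 0) (h : H) :
    adjoint (h : G) X = X := by
  by_contra hne
  have hpos := hB.pos _ (sub_ne_zero.2 hne)
  have h1 : ∀ Y, B (adjoint (h : G) X) Y = B X Y := by
    intro Y
    have h2 := eq_of_leftDeriv_eq_zero (F := F) (f := adCoeff (H := H) B X Y)
      ((contMDiff_adCoeff hHG B X Y).mdifferentiable (by simp))
      (fun A g => by rw [leftDeriv_adCoeff hHG, hX]; simp [adCoeff]) h 1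
    have h3 : B (adjoint (h : G) X) Y = B (adjoint (1 : G) X) Y := h2
    rwa [adjoint_one_apply] at h3
  rw [map_sub (B), LinearMap.sub_apply, h1, sub_self] at hpos
  exact lt_irrefl _ hpos

/-- A vector which commutes with generators of `𝔥` commutes with `𝔥`. -/
lemma lie_eq_zero_of_isLieGenerating {N : ℕ} {A : Fin N → GroupLieAlgebra 𝓘(ℝ, F) H}
    (hA : IsLieGenerating (E := E) H A) {X : GroupLieAlgebra 𝓘(ℝ, E) G}
    (hX : ∀ k, ⁅(lieIncl H (A k) : GroupLieAlgebra 𝓘(ℝ, E) G), X⁆ = 0)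
    (a : GroupLieAlgebra 𝓘(ℝ, F) H) :
    ⁅(lieIncl H a : GroupLieAlgebra 𝓘(ℝ, E) G), X⁆ = 0 := by
  -- The centraliser of `X` is a subalgebra by the Jacobi identity.
  let C : LieSubalgebra ℝ (GroupLieAlgebra 𝓘(ℝ, E) G) :=
    { carrier := {Z | ⁅Z, X⁆ = 0}
      add_mem' := fun {a b} ha hb => by
        simp only [Set.mem_ofPred_eq] at *
        rw [add_lie, ha, hb, add_zero]
      zero_mem' := zero_lie X
      smul_mem' := fun c a ha => by
        simp only [Set.mem_ofPred_eq] at *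
        rw [smul_lie, ha, smul_zero]
      lie_mem' := fun {a b} ha hb => by
        change ⁅⁅a, b⁆, X⁆ = 0
        have ha' : ⁅a, X⁆ = 0 := ha
        have hb' : ⁅b, X⁆ = 0 := hb
        rw [lie_lie, ha', hb', lie_zero, lie_zero, sub_zero] }
  have hle : LieSubalgebra.lieSpan ℝ (GroupLieAlgebra 𝓘(ℝ, E) G)
      (Set.range fun k => (lieIncl H (A k) : GroupLieAlgebra 𝓘(ℝ, E) G)) ≤ C := by
    rw [LieSubalgebra.lieSpan_le]
    rintro _ ⟨k, rfl⟩
    exact hX k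
  have ha : (lieIncl H a : GroupLieAlgebra 𝓘(ℝ, E) G) ∈ lieSubspace (F := F) H := ⟨a, rfl⟩
  rw [← hA] at ha
  exact hle ha

end Subgroup
-- The correlation form of the coefficients.
section Averaging

set_option linter.unusedSectionVars false

open MeasureTheory

variable {E : Type*} [NormedAddCommGroup E] [NormedSpace ℝ E] [FiniteDimensional ℝ E]
  [CompleteSpace E]
  {G : Type*} [TopologicalSpace G] [ChartedSpace E G] [Group G] [LieGroup 𝓘(ℝ, E) ∞ G]
  {F : Type*} [NormedAddCommGroup F] [NormedSpace ℝ F]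
  {H : Subgroup G} [ChartedSpace F H]

lemma adCoeff_add_right (B : LinearMap.BilinForm ℝ (GroupLieAlgebra 𝓘(ℝ, E) G))
    (X Y Z : GroupLieAlgebra 𝓘(ℝ, E) G) (h : H) :
    adCoeff B X (Y + Z) h = adCoeff B X Y h + adCoeff B X Z h := by
  simp only [adCoeff, map_add]

lemma adCoeff_smul_right (B : LinearMap.BilinForm ℝ (GroupLieAlgebra 𝓘(ℝ, E) G))
    (c : ℝ) (X Y : GroupLieAlgebra 𝓘(ℝ, E) G) (h : H) :
    adCoeff B X (c • Y) h = c * adCoeff B X Y h := by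
  simp only [adCoeff, map_smul, smul_eq_mul]

lemma adCoeff_smul_left (B : LinearMap.BilinForm ℝ (GroupLieAlgebra 𝓘(ℝ, E) G))
    (c : ℝ) (X Y : GroupLieAlgebra 𝓘(ℝ, E) G) (h : H) :
    adCoeff B (c • X) Y h = c * adCoeff B X Y h := by
  simp only [adCoeff, map_smul, LinearMap.smul_apply, smul_eq_mul]

variable [MeasurableSpace G] [BorelSpace G]

lemma integrable_adCoeff_mul (hHG : IsEmbeddedSubgroup (E := E) (F := F) H) [CompactSpace H]
    (μ : Measure H) [IsFiniteMeasure μ]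
    (B : LinearMap.BilinForm ℝ (GroupLieAlgebra 𝓘(ℝ, E) G))
    (X Y Z : GroupLieAlgebra 𝓘(ℝ, E) G) :
    Integrable (fun h : H => adCoeff B X Y h * adCoeff B X Z h) μ :=
  ((contMDiff_adCoeff hHG B X Y).continuous.mul
    (contMDiff_adCoeff hHG B X Z).continuous).integrable_of_hasCompactSupport
      (HasCompactSupport.of_compactSpace _)

/-- The correlation form `(Y, Z) ↦ ∫_H ⟨Ad(h) X, Y⟩ ⟨Ad(h) X, Z⟩ dh`. -/
noncomputable def correlationForm (hHG : IsEmbeddedSubgroup (E := E) (F := F) H) [CompactSpace H]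
    (μ : Measure H) [IsFiniteMeasure μ]
    (B : LinearMap.BilinForm ℝ (GroupLieAlgebra 𝓘(ℝ, E) G))
    (X : GroupLieAlgebra 𝓘(ℝ, E) G) : LinearMap.BilinForm ℝ (GroupLieAlgebra 𝓘(ℝ, E) G) :=
  LinearMap.mk₂ ℝ (fun Y Z => ∫ h : H, adCoeff B X Y h * adCoeff B X Z h ∂μ)
    (fun Y Y' Z => by
      simp only [adCoeff_add_right, add_mul]
      exact integral_add (integrable_adCoeff_mul hHG μ B X Y Z)
        (integrable_adCoeff_mul hHG μ B X Y' Z))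
    (fun c Y Z => by
      simp only [adCoeff_smul_right, mul_assoc, smul_eq_mul]
      exact integral_const_mul _ _)
    (fun Y Z Z' => by
      simp only [adCoeff_add_right, mul_add]
      exact integral_add (integrable_adCoeff_mul hHG μ B X Y Z)
        (integrable_adCoeff_mul hHG μ B X Y Z'))
    (fun c Y Z => by
      simp only [adCoeff_smul_right, mul_left_comm _ c, smul_eq_mul]
      exact integral_const_mul _ _)

variable [LieGroup 𝓘(ℝ, F) ∞ H] [CompleteSpace F]

/-- `ad A` is skew for the correlation form. -/
lemma correlationForm_lie_skew (hHG : IsEmbeddedSubgroup (E := E) (F := F) H) [CompactSpace H]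
    (hc : ∀ x ∈ H, ∀ y ∈ H, x * y = y * x)
    (μ : Measure H) [IsFiniteMeasure μ] [μ.IsMulRightInvariant]
    {B : LinearMap.BilinForm ℝ (GroupLieAlgebra 𝓘(ℝ, E) G)} (hB : IsAdInvariantInner H B)
    (A : GroupLieAlgebra 𝓘(ℝ, F) H) (X Y Z : GroupLieAlgebra 𝓘(ℝ, E) G) :
    correlationForm hHG μ B X ⁅(lieIncl H A : GroupLieAlgebra 𝓘(ℝ, E) G), Y⁆ Z
      = - correlationForm hHG μ B X Y ⁅(lieIncl H A : GroupLieAlgebra 𝓘(ℝ, E) G), Z⁆ := by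
  -- Skewness moves `ad A` from `Y` onto `Ad h X`, and commutation moves it inside `Ad h`, where it
  -- is a derivative of the coefficient.
  have h1 : ∀ (Y : GroupLieAlgebra 𝓘(ℝ, E) G) (h : H),
      adCoeff B X ⁅(lieIncl H A : GroupLieAlgebra 𝓘(ℝ, E) G), Y⁆ h
        = - leftDeriv A (adCoeff (H := H) B X Y) h := by
    intro Y h
    rw [leftDeriv_adCoeff hHG, adCoeff, adCoeff, adjoint_lie_of_comm hHG hc,
      hB.lie_skew hHG, neg_neg]
  change ∫ h : H, _ * _ ∂μ = - ∫ h : H, _ * _ ∂μ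
  simp only [h1, neg_mul, mul_neg, integral_neg, neg_neg]
  rw [integral_leftDeriv_mul μ ((contMDiff_adCoeff hHG B X Y).of_le (by simp))
    ((contMDiff_adCoeff hHG B X Z).of_le (by simp)), neg_neg]

/-- The trace of the correlation form. -/
lemma sum_correlationForm (hHG : IsEmbeddedSubgroup (E := E) (F := F) H) [CompactSpace H]
    (μ : Measure H) [IsProbabilityMeasure μ]
    {B : LinearMap.BilinForm ℝ (GroupLieAlgebra 𝓘(ℝ, E) G)} (hB : IsAdInvariantInner H B)
    {V : Submodule ℝ (GroupLieAlgebra 𝓘(ℝ, E) G)} (hV : IsAdInvariant H V)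
    {X : GroupLieAlgebra 𝓘(ℝ, E) G} (hX : X ∈ V) {d : ℕ}
    {Y : Fin d → GroupLieAlgebra 𝓘(ℝ, E) G} (hY : IsOrthonormalBasisOf B V Y) :
    ∑ i, correlationForm hHG μ B X (Y i) (Y i) = B X X := by
  change ∑ i, ∫ h : H, adCoeff B X (Y i) h * adCoeff B X (Y i) h ∂μ = _
  rw [← integral_finsetSum _ fun i _ => integrable_adCoeff_mul hHG μ B X (Y i) (Y i)]
  -- The integrand is constant: Parseval for `Ad h X`, and `Ad h` is an isometry.
  have : ∀ h : H, ∑ i, adCoeff B X (Y i) h * adCoeff B X (Y i) h = B X X := fun h =>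
    (hY.sum_mul_eq hB.symm (hV h h.2 X hX) _).trans (hB.invariant h h.2 X X)
  simp [this]

end Averaging

/-! ### The summands `𝔪ₗ`, `l ≠ 0`: eigenvalue and dimension. -/

section Decomposition

set_option linter.unusedSectionVars false

variable {E : Type*} [NormedAddCommGroup E] [NormedSpace ℝ E] [FiniteDimensional ℝ E]
  [CompleteSpace E]
  {G : Type*} [TopologicalSpace G] [ChartedSpace E G] [Group G] [LieGroup 𝓘(ℝ, E) ∞ G]
  {F : Type*} [NormedAddCommGroup F] [NormedSpace ℝ F]
  {H : Subgroup G} [ChartedSpace F H] [LieGroup 𝓘(ℝ, F) ∞ H]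

/-- No nonzero vector of `𝔪ₗ`, `l ≠ 0`, commutes with generators of `𝔥`. -/
lemma IsAdDecomposition.exists_lie_ne_zero [PreconnectedSpace H]
    (hHG : IsEmbeddedSubgroup (E := E) (F := F) H)
    {B : LinearMap.BilinForm ℝ (GroupLieAlgebra 𝓘(ℝ, E) G)} (hB : IsAdInvariantInner H B)
    {r : ℕ} {𝔪 : Fin (r + 1) → Submodule ℝ (GroupLieAlgebra 𝓘(ℝ, E) G)}
    (h𝔪 : IsAdDecomposition (F := F) H B 𝔪)
    {N : ℕ} {A : Fin N → GroupLieAlgebra 𝓘(ℝ, F) H} (hA : IsLieGenerating (E := E) H A)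
    {l : Fin (r + 1)} (hl : l ≠ 0) {X : GroupLieAlgebra 𝓘(ℝ, E) G} (hX : X ∈ 𝔪 l) (hX0 : X ≠ 0) :
    ∃ k, ⁅(lieIncl H (A k) : GroupLieAlgebra 𝓘(ℝ, E) G), X⁆ ≠ 0 := by
  by_contra! hcon
  have h1 : X ∈ B.orthogonal (lieSubspace (F := F) H) :=
    h𝔪.iSup_eq ▸ (le_iSup 𝔪 l) hX
  have h2 : X ∈ 𝔪 0 := (h𝔪.mem_zero X).2 ⟨h1, fun h hh =>
    adjoint_eq_self_of_lie_eq_zero hHG hB (lie_eq_zero_of_isLieGenerating hA hcon) ⟨h, hh⟩⟩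
  exact (hB.pos X hX0).ne' (h𝔪.orthogonal l 0 hl X hX X h2)

/-- Supplies the involution `σ h = h⁻¹` required by `eq_span_pair_of_skew_of_commute`. -/
lemma IsAdInvariantInner.adjoint_inv
    {B : LinearMap.BilinForm ℝ (GroupLieAlgebra 𝓘(ℝ, E) G)} (hB : IsAdInvariantInner H B)
    (h : H) (X Y : GroupLieAlgebra 𝓘(ℝ, E) G) :
    B (adjoint (h : G) X) Y = B X (adjoint ((h⁻¹ : H) : G) Y) := by
  rw [← hB.invariant _ (h⁻¹ : H).2 (adjoint (h : G) X), ← adjoint_mul_apply, InvMemClass.coe_inv,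
    inv_mul_cancel, adjoint_one_apply]

/-- `½ ∑ₖ ad²(Aₖ)` is a negative scalar on `𝔪ₗ`, `l ≠ 0`. -/
lemma IsAdDecomposition.exists_eigenvalue [PreconnectedSpace H]
    (hHG : IsEmbeddedSubgroup (E := E) (F := F) H) (hc : ∀ x ∈ H, ∀ y ∈ H, x * y = y * x)
    {B : LinearMap.BilinForm ℝ (GroupLieAlgebra 𝓘(ℝ, E) G)} (hB : IsAdInvariantInner H B)
    {r : ℕ} {𝔪 : Fin (r + 1) → Submodule ℝ (GroupLieAlgebra 𝓘(ℝ, E) G)}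
    (h𝔪 : IsAdDecomposition (F := F) H B 𝔪)
    {N : ℕ} {A : Fin N → GroupLieAlgebra 𝓘(ℝ, F) H} (hA : IsLieGenerating (E := E) H A)
    {l : Fin (r + 1)} (hl : l ≠ 0) :
    ∃ lam : ℝ, 0 < lam ∧ ∀ X ∈ 𝔪 l,
      (1 / 2 : ℝ) • ∑ k, ⁅(lieIncl H (A k) : GroupLieAlgebra 𝓘(ℝ, E) G),
          ⁅(lieIncl H (A k) : GroupLieAlgebra 𝓘(ℝ, E) G), X⁆⁆ = -(lam • X) := by
  have : FiniteDimensional ℝ (GroupLieAlgebra 𝓘(ℝ, E) G) :=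
    inferInstanceAs (FiniteDimensional ℝ E)
  let ad : Fin N → Module.End ℝ (GroupLieAlgebra 𝓘(ℝ, E) G) :=
    fun k => LieAlgebra.ad ℝ _ (lieIncl H (A k))
  let T : Module.End ℝ (GroupLieAlgebra 𝓘(ℝ, E) G) := (1 / 2 : ℝ) • ∑ k, ad k * ad k
  have hT : ∀ X, T X = (1 / 2 : ℝ) • ∑ k, ⁅(lieIncl H (A k) : GroupLieAlgebra 𝓘(ℝ, E) G),
      ⁅(lieIncl H (A k) : GroupLieAlgebra 𝓘(ℝ, E) G), X⁆⁆ := fun X => by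
    simp [T, ad, LinearMap.sum_apply]
  have hV := h𝔪.irreducible l hl
  obtain ⟨c, hcT⟩ := scalar_of_symmetric_of_commute B hB.symm hB.pos
    (fun h : H => (adjoint (h : G) : GroupLieAlgebra 𝓘(ℝ, E) G →L[ℝ] _).toLinearMap) (𝔪 l)
    hV.ne_bot (fun h X hX => hV.invariant h h.2 X hX)
    (fun W hW hWi => hV.eq_bot_or_eq W hW fun h hh X hX => hWi ⟨h, hh⟩ X hX) T
    (fun X hX => by
      rw [hT]
      exact Submodule.smul_mem _ _ (Submodule.sum_mem _ fun k _ =>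
        lie_mem_of_isAdInvariant hHG hV.invariant _ (lie_mem_of_isAdInvariant hHG hV.invariant _ hX)))
    (fun X _ Y _ => by
      simp only [hT, map_smul, map_sum, LinearMap.smul_apply, LinearMap.sum_apply,
        hB.lie_skew hHG, neg_neg])
    (fun h X _ => by
      simp only [hT, ContinuousLinearMap.coe_coe, map_smul, map_sum, adjoint_lie_of_comm hHG hc])
  obtain ⟨X, hX, hX0⟩ := Submodule.exists_mem_ne_zero_of_ne_bot hV.ne_bot
  obtain ⟨k, hk⟩ := h𝔪.exists_lie_ne_zero hHG hB hA hl hX hX0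
  -- Minus half a sum of squares, one of them nonzero, so the scalar is strictly negative.
  have h1 : B (T X) X = -(1 / 2 * ∑ k, B ⁅(lieIncl H (A k) : GroupLieAlgebra 𝓘(ℝ, E) G), X⁆
      ⁅(lieIncl H (A k) : GroupLieAlgebra 𝓘(ℝ, E) G), X⁆) := by
    rw [hT, map_smul, map_sum, LinearMap.smul_apply, LinearMap.sum_apply,
      Finset.sum_congr rfl fun k _ => hB.lie_skew hHG (A k) _ X, Finset.sum_neg_distrib,
      smul_eq_mul, mul_neg]
  have hnn : ∀ Z, 0 ≤ B Z Z := fun Z => by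
    rcases eq_or_ne Z 0 with rfl | h
    · simp
    · exact (hB.pos Z h).le
  have h2 : 0 < ∑ k, B ⁅(lieIncl H (A k) : GroupLieAlgebra 𝓘(ℝ, E) G), X⁆
      ⁅(lieIncl H (A k) : GroupLieAlgebra 𝓘(ℝ, E) G), X⁆ :=
    Finset.sum_pos' (fun k _ => hnn _) ⟨k, Finset.mem_univ k, hB.pos _ hk⟩
  rw [hcT X hX, map_smul, LinearMap.smul_apply, smul_eq_mul] at h1
  refine ⟨-c, ?_, fun X hX => by rw [← hT, hcT X hX, neg_smul, neg_neg]⟩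
  have := hB.pos X hX0
  by_contra hcon
  nlinarith [mul_nonneg (show 0 ≤ c by linarith) this.le]

/-- `𝔪ₗ`, `l ≠ 0`, is a plane spanned by `X` and `[a, X]` for some `a ∈ 𝔥`. -/
lemma IsAdDecomposition.exists_span_pair [PreconnectedSpace H]
    (hHG : IsEmbeddedSubgroup (E := E) (F := F) H) (hc : ∀ x ∈ H, ∀ y ∈ H, x * y = y * x)
    {B : LinearMap.BilinForm ℝ (GroupLieAlgebra 𝓘(ℝ, E) G)} (hB : IsAdInvariantInner H B)
    {r : ℕ} {𝔪 : Fin (r + 1) → Submodule ℝ (GroupLieAlgebra 𝓘(ℝ, E) G)}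
    (h𝔪 : IsAdDecomposition (F := F) H B 𝔪)
    {N : ℕ} {A : Fin N → GroupLieAlgebra 𝓘(ℝ, F) H} (hA : IsLieGenerating (E := E) H A)
    {l : Fin (r + 1)} (hl : l ≠ 0) :
    ∃ (a : GroupLieAlgebra 𝓘(ℝ, F) H) (c : ℝ) (X : GroupLieAlgebra 𝓘(ℝ, E) G), 0 < c ∧ X ≠ 0 ∧
      ⁅(lieIncl H a : GroupLieAlgebra 𝓘(ℝ, E) G),
        ⁅(lieIncl H a : GroupLieAlgebra 𝓘(ℝ, E) G), X⁆⁆ = -(c • X) ∧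
      𝔪 l = Submodule.span ℝ {X, ⁅(lieIncl H a : GroupLieAlgebra 𝓘(ℝ, E) G), X⁆} := by
  have : FiniteDimensional ℝ (GroupLieAlgebra 𝓘(ℝ, E) G) :=
    inferInstanceAs (FiniteDimensional ℝ E)
  have hV := h𝔪.irreducible l hl
  obtain ⟨X, hX, hX0⟩ := Submodule.exists_mem_ne_zero_of_ne_bot hV.ne_bot
  obtain ⟨k, hk⟩ := h𝔪.exists_lie_ne_zero hHG hB hA hl hX hX0
  obtain ⟨c, hc0, hJJ, hspan⟩ := eq_span_pair_of_skew_of_commute B hB.symm hB.pos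
    (fun h : H => (adjoint (h : G) : GroupLieAlgebra 𝓘(ℝ, E) G →L[ℝ] _).toLinearMap)
    (fun h => h⁻¹) (fun h X Y => hB.adjoint_inv h X Y)
    (fun h X Y => by
      have := hB.adjoint_inv h⁻¹ X Y
      rwa [inv_inv] at this)
    (fun h h' X => by
      change adjoint (h : G) (adjoint (h' : G) X) = adjoint (h' : G) (adjoint (h : G) X)
      rw [← adjoint_mul_apply, ← adjoint_mul_apply, hc _ h.2 _ h'.2])
    (𝔪 l) hV.ne_bot (fun h X hX => hV.invariant h h.2 X hX)
    (fun W hW hWi => hV.eq_bot_or_eq W hW fun h hh X hX => hWi ⟨h, hh⟩ X hX)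
    (LieAlgebra.ad ℝ _ (lieIncl H (A k)))
    (fun X hX => lie_mem_of_isAdInvariant hHG hV.invariant _ hX)
    (fun X Y => hB.lie_skew hHG (A k) X Y)
    (fun h X => (adjoint_lie_of_comm hHG hc (A k) h X).symm) ⟨X, hX, hk⟩
  exact ⟨A k, c, X, hc0, hX0, hJJ X hX, hspan X hX hX0⟩

/-- `𝔪ₗ`, `l ≠ 0`, has dimension two. -/
lemma IsAdDecomposition.finrank_eq_two [PreconnectedSpace H]
    (hHG : IsEmbeddedSubgroup (E := E) (F := F) H) (hc : ∀ x ∈ H, ∀ y ∈ H, x * y = y * x)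
    {B : LinearMap.BilinForm ℝ (GroupLieAlgebra 𝓘(ℝ, E) G)} (hB : IsAdInvariantInner H B)
    {r : ℕ} {𝔪 : Fin (r + 1) → Submodule ℝ (GroupLieAlgebra 𝓘(ℝ, E) G)}
    (h𝔪 : IsAdDecomposition (F := F) H B 𝔪)
    {N : ℕ} {A : Fin N → GroupLieAlgebra 𝓘(ℝ, F) H} (hA : IsLieGenerating (E := E) H A)
    {l : Fin (r + 1)} (hl : l ≠ 0) : Module.finrank ℝ (𝔪 l) = 2 := by
  obtain ⟨a, c, X, hc0, hX0, hJJ, hspan⟩ := h𝔪.exists_span_pair hHG hc hB hA hl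
  set JX := ⁅(lieIncl H a : GroupLieAlgebra 𝓘(ℝ, E) G), X⁆ with hJX
  -- `X` and `JX` are orthogonal by skewness, and `JX ≠ 0` because `[a, JX] = -(c • X) ≠ 0`; hence
  -- they are independent.
  have h0 : B X JX = 0 := by linarith [hB.lie_skew hHG a X X, hB.symm X JX]
  have hJX0 : JX ≠ 0 := fun h => by
    rw [h, lie_zero, eq_comm, neg_eq_zero, smul_eq_zero] at hJJ
    exact hJJ.elim hc0.ne' hX0
  have hli : LinearIndependent ℝ ![X, JX] := by
    rw [LinearIndependent.pair_iff]
    intro s t hst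
    have h1 : B (s • X + t • JX) X = 0 := by rw [hst]; simp
    have h2 : B (s • X + t • JX) JX = 0 := by rw [hst]; simp
    simp only [map_add, map_smul, LinearMap.add_apply, LinearMap.smul_apply, smul_eq_mul,
      hB.symm JX X, h0, mul_zero, add_zero, zero_add, mul_eq_zero, (hB.pos X hX0).ne',
      (hB.pos JX hJX0).ne', or_false] at h1 h2
    exact ⟨h1, h2⟩
  have := finrank_span_eq_card hli
  rwa [Matrix.range_cons_cons_empty, ← hspan, Fintype.card_fin] at this

end Decomposition
end EffectiveLimit

/-! ### The effective operator. -/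

theorem mainTheorem8
    {E : Type*} [NormedAddCommGroup E] [NormedSpace ℝ E] [FiniteDimensional ℝ E] [CompleteSpace E]
    {G : Type*} [TopologicalSpace G] [T2Space G] [ConnectedSpace G] [ChartedSpace E G]
    [Group G] [LieGroup 𝓘(ℝ, E) ∞ G] [MeasurableSpace G] [BorelSpace G]
    (hG : LieAlgebra.IsSemisimple ℝ (GroupLieAlgebra 𝓘(ℝ, E) G))
    {F : Type*} [NormedAddCommGroup F] [NormedSpace ℝ F] [FiniteDimensional ℝ F]
    (H : Subgroup G) [ChartedSpace F H] [LieGroup 𝓘(ℝ, F) ∞ H]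
    (hHG : IsEmbeddedSubgroup (E := E) (F := F) H) (hH : IsMaximalTorus H)
    (μ : MeasureTheory.Measure H) [μ.IsHaarMeasure] [MeasureTheory.IsProbabilityMeasure μ]
    (B : LinearMap.BilinForm ℝ (GroupLieAlgebra 𝓘(ℝ, E) G)) (hB : IsAdInvariantInner H B)
    {r : ℕ} (𝔪 : Fin (r + 1) → Submodule ℝ (GroupLieAlgebra 𝓘(ℝ, E) G))
    (h𝔪 : IsAdDecomposition (F := F) H B 𝔪)
    {N : ℕ} (A : Fin N → GroupLieAlgebra 𝓘(ℝ, F) H) (hA : IsLieGenerating (E := E) H A)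
    (l : Fin (r + 1)) (hl : l ≠ 0) :
    ∃ lam : ℝ, 0 < lam ∧
      (∀ c : ℝ,
        (∀ X ∈ 𝔪 l, (1 / 2 : ℝ) • ∑ k, ⁅(lieIncl H (A k) : GroupLieAlgebra 𝓘(ℝ, E) G),
          ⁅(lieIncl H (A k) : GroupLieAlgebra 𝓘(ℝ, E) G), X⁆⁆ = -(c • X)) ↔ c = lam) ∧
      ∀ Y₀ ∈ 𝔪 l, ∀ {d : ℕ} (Y : Fin d → GroupLieAlgebra 𝓘(ℝ, E) G),
        IsOrthonormalBasisOf B (𝔪 l) Y →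
        (∀ j, ∃ β : H → ℝ, ContMDiff 𝓘(ℝ, F) 𝓘(ℝ, ℝ) ∞ β ∧
          IsPoissonSolution 0 A (adCoeff B Y₀ (Y j)) β) ∧
        ∀ β : Fin d → H → ℝ,
          (∀ j, IsPoissonSolution 0 A (adCoeff B Y₀ (Y j)) (β j)) →
          ∀ Z : Fin d → GroupLieAlgebra 𝓘(ℝ, E) G, IsOrthonormalBasisOf B (𝔪 l) Z →
          ∀ f : G → ℝ, ContMDiff 𝓘(ℝ, E) 𝓘(ℝ, ℝ) 2 f →
          ∀ g : G, effectiveOp μ B Y₀ Y β f g = B Y₀ Y₀ / (2 * lam) * sumSquares Z f g := by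
  have hHc : CompactSpace H := isCompact_iff_compactSpace.1 hH.compact
  have hHp : PreconnectedSpace H :=
    isPreconnected_iff_preconnectedSpace.1 hH.connected.isPreconnected
  have hFc : CompleteSpace F := FiniteDimensional.complete ℝ F
  have hc := hH.comm
  -- On an abelian group right translations are left translations.
  have hμ : μ.IsMulRightInvariant := ⟨fun g => by
    have : (fun x : H => x * g) = fun x => g * x := by
      ext x; exact hc _ x.2 _ g.2
    rw [this, MeasureTheory.map_mul_left_eq_self]⟩
  have hV := h𝔪.irreducible l hl
  obtain ⟨lam, hlam, hT⟩ := h𝔪.exists_eigenvalue hHG hc hB hA hl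
  refine ⟨lam, hlam, fun c => ⟨fun h => ?_, fun h => h ▸ hT⟩, ?_⟩
  · obtain ⟨X, hX, hX0⟩ := Submodule.exists_mem_ne_zero_of_ne_bot hV.ne_bot
    exact smul_left_injective ℝ hX0 (neg_injective ((h X hX).symm.trans (hT X hX)))
  intro Y₀ hY₀ d Y hY
  have hsm : ∀ X Z, ContMDiff 𝓘(ℝ, F) 𝓘(ℝ, ℝ) 2 (adCoeff (H := H) B X Z) := fun X Z =>
    (contMDiff_adCoeff hHG B X Z).of_le (WithTop.coe_le_coe.2 le_top)
  -- The coefficient is an eigenfunction with eigenvalue `-lam`, so dividing by `-lam` solves the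
  -- equation.
  refine ⟨fun j => ⟨adCoeff B (-lam⁻¹ • Y₀) (Y j), contMDiff_adCoeff hHG B _ _, hsm _ _,
    fun h => ?_⟩, ?_⟩
  · rw [hormanderOp_adCoeff hHG, hT _ (Submodule.smul_mem _ _ hY₀), smul_smul, ← neg_smul,
      mul_neg, neg_neg, mul_inv_cancel₀ hlam.ne', one_smul]
  intro β hβ Z hZ f hf g
  obtain ⟨a, c, X, hc0, hX0, hJJ, hspan⟩ := h𝔪.exists_span_pair hHG hc hB hA hl
  obtain ⟨q, hq⟩ := eq_smul_of_skew B (correlationForm hHG μ B Y₀) hB.pos hB.symm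
    (fun X X' => by
      change ∫ h : H, _ * _ ∂μ = ∫ h : H, _ * _ ∂μ
      simp only [mul_comm])
    (LieAlgebra.ad ℝ _ (lieIncl H a)) (fun X X' => hB.lie_skew hHG a X X')
    (fun X _ X' _ => correlationForm_lie_skew hHG hc μ hB a Y₀ X X') hX0 hJJ hspan
  have hd : d = 2 := hY.finrank_eq.symm.trans (h𝔪.finrank_eq_two hHG hc hB hA hl)
  -- Compare traces over `Y`: `2 q = B Y₀ Y₀`.
  have hq2 : q = B Y₀ Y₀ / 2 := by
    have := sum_correlationForm hHG μ hB hV.invariant hY₀ hY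
    simp only [hq _ (hY.mem _) _ (hY.mem _), hY.orthonormal, if_true, mul_one, Finset.sum_const,
      Finset.card_univ, Fintype.card_fin, hd, nsmul_eq_mul] at this
    push_cast at this
    linarith
  -- Symmetry of `𝓛₀` moves it from `β j` onto the eigenfunction, so the integral is the same for
  -- every solution `β j`.
  have hint : ∀ i j, ∫ h : H, adCoeff B Y₀ (Y i) h * β j h ∂μ
      = -lam⁻¹ * (q * if i = j then 1 else 0) := by
    intro i j
    have h1 := integral_hormanderOp_mul μ (hsm Y₀ (Y i)) (hβ j).contMDiff A
    have h2 : ∀ h : H, hormanderOp 0 A (adCoeff (H := H) B Y₀ (Y i)) h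
        = -lam * adCoeff B Y₀ (Y i) h := fun h => by
      rw [hormanderOp_adCoeff hHG, hT _ hY₀, ← neg_smul, adCoeff_smul_left]
    simp only [h2, (hβ j).eq, mul_assoc, MeasureTheory.integral_const_mul] at h1
    have h3 : ∫ h : H, adCoeff B Y₀ (Y i) h * adCoeff B Y₀ (Y j) h ∂μ
        = q * if i = j then 1 else 0 := by
      rw [← hY.orthonormal]; exact hq _ (hY.mem i) _ (hY.mem j)
    rw [← h3, ← h1]
    field_simp
  rw [sumSquares_eq hZ hY hB.symm hf]
  simp only [effectiveOp, hint, sumSquares, Finset.mul_sum, mul_ite, mul_one, mul_zero, ite_mul,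
    zero_mul, Finset.sum_ite_eq, Finset.mem_univ, if_true, ← Finset.sum_neg_distrib]
  refine Finset.sum_congr rfl fun i _ => ?_
  rw [hq2]
  field_simp
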